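/- **Conventions.** Let $(X,d)$ be a metric space. A geodesic from $x$ to $y$ is a map $\gamma:[0,1]\to X$ with $\gamma(0)=x$, $\gamma(1)=y$ and $d(\gamma(s),\gamma(t))=|s-t|\,d(x,y)$. A set $C\subset X$ is convex if it contains every geodesic between any two of its points. $\operatorname{conv}A=\bigcup_n G_n$, where $G_0=A$ and $G_{n+1}$ is the union of all geodesics between points of $G_n$. The co-convex topology $\tau_{co}$ is the weakest topology containing all complements of closed convex sets. For $a,b\ge 0$ put $\mathcal M^p(a,b)=(\frac12a^p+\frac12b^p)^{1/p}$ for $p\in[1,\infty)$ and $\mathcal M^\infty(a,b)=\max\{a,b\}$. $X$ is uniformly $p$-convex if any two points have a midpoint and for every $\varepsilon>0$ there is $\rho\in(0,1)$ such that $d(m,z)\le(1-\rho)\mathcal M^p(d(x,z),d(y,z))$ whenever $m$ is a midpoint of $x,y$ and $d(x,y)>\varepsilon\mathcal M^p(d(x,z),d(y,z))$ (for $p=1$: $d(x,y)>|d(x,z)-d(y,z)|+\varepsilon\mathcal M^1(d(x,z),d(y,z))$). A sequence $(x_n)$ converges weakly sequentially to $x$ if, for every subsequence $(x_{n'})$,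 the point $x$ is the unique minimizer of $y\mapsto\limsup d(y,x_{n'})$. $X$ has property (N) if for every geodesic segment $I$, all $x,y\in X$ and every $m$ on a geodesic from $x$ to $y$, the projection of $m$ onto $I$ lies on a geodesic between the projections of $x$ and $y$ onto $I$. **Statement.** Let $H$ be an infinite-dimensional (real or complex) Hilbert space with its norm metric $d_H$, and let $C(H)$ be the Euclidean cone over $H$: the set $H\times[0,\infty)$ with all points $(x,0)$ identified, with the metric $$d((x,t),(x',t'))^2=t^2+t'^2-2tt'\cos(\min\{\pi,d_H(x,x')\}).$$ Then: 1. $C(H)$ is a complete $CAT(0)$ space, it is uniformly $p$-convex for every $p\in[1,\infty]$, and its bounded closed convex subsets are compact in the co-convex topology. 2. On $H$ itself the co-convex topology agrees with the weak topology. 3. The co-convex topology of $C(H)$ is not Hausdorff. 4. Let $(e_n)$ be an orthonormal sequence in $H$. There are $0\le a<b$ with $a\le\cos 1$ and $\cos^2(\tfrac{\sqrt2}{2})\le b$ such that for every subsequence $(e_{n'})$ $$\bigcap_{m\in\mathbb N}\overline{\operatorname{conv}\{(e_{n'},1) : n'\ge m\}}=\{(\mathbf 0,r) : r\in[a,b]\},$$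 and the set of all limits of the sequence $((e_n,1))_n$ in the co-convex topology is exactly the segment $\{(\mathbf 0,r) : r\in[a,b]\}$. On the other hand, $(e_n,1)$ converges weakly sequentially to $(\mathbf 0,\cos 1)$, and only to this point. 5. $C(H)$ does not have property (N). -/

import Mathlib

open Filter Set
open scoped NNReal ENNReal Topology

/-! ### The Euclidean cone over a metric space -/

section Cone

variable (X : Type*) [MetricSpace X]

/-- The relation on `X × [0, ∞)` that identifies all points with radius `0` and nothing else. -/
def coneSetoid : Setoid (X × ℝ≥0) where
  r p q := p = q ∨ (p.2 = 0 ∧ q.2 = 0)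
  iseqv :=
    { refl := fun _ => Or.inl rfl
      symm := by
        rintro p q (h | ⟨h, h'⟩)
        · exact Or.inl h.symm
        · exact Or.inr ⟨h', h⟩
      trans := by
        rintro p q r (rfl | ⟨h, h'⟩) (rfl | ⟨k, k'⟩)
        · exact Or.inl rfl
        · exact Or.inr ⟨k, k'⟩
        · exact Or.inr ⟨h, h'⟩
        · exact Or.inr ⟨h, k'⟩ }

/-- The underlying set of the Euclidean cone over `X`: `X × [0, ∞)` with `X × {0}` collapsed to a
single point, the apex. -/
def EuclideanCone : Type _ := Quotient (coneSetoid X)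

variable {X}

/-- The distance `√(t² + t'² - 2 t t' cos (min {π, d (x, x')}))` of `(x, t)` and `(x', t')`. -/
noncomputable def coneDist (p q : X × ℝ≥0) : ℝ :=
  Real.sqrt ((p.2 : ℝ) ^ 2 + (q.2 : ℝ) ^ 2
    - 2 * (p.2 : ℝ) * (q.2 : ℝ) * Real.cos (min Real.pi (dist p.1 q.1)))

theorem coneDist_comm (p q : X × ℝ≥0) : coneDist p q = coneDist q p := by
  unfold coneDist
  rw [dist_comm]
  congr 1
  ring

theorem coneDist_congr {p q p' q' : X × ℝ≥0} (h : (coneSetoid X).r p p')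
    (k : (coneSetoid X).r q q') : coneDist p q = coneDist p' q' := by
  unfold coneDist
  rcases h with rfl | ⟨h, h'⟩ <;> rcases k with rfl | ⟨k, k'⟩ <;> simp [*]

theorem coneDist_self (p : X × ℝ≥0) : coneDist p p = 0 := by
  unfold coneDist
  rw [dist_self, min_eq_right Real.pi_pos.le, Real.cos_zero]
  have : (p.2 : ℝ) ^ 2 + (p.2 : ℝ) ^ 2 - 2 * (p.2 : ℝ) * (p.2 : ℝ) * 1 = 0 := by ring
  rw [this, Real.sqrt_zero]

/-- The law of cosines in the complex plane. -/
theorem norm_polar_sub (r s α β : ℝ) :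
    ‖(r : ℂ) * Complex.exp (α * Complex.I) - s * Complex.exp (β * Complex.I)‖
      = Real.sqrt (r ^ 2 + s ^ 2 - 2 * r * s * Real.cos (α - β)) := by
  rw [Complex.norm_eq_sqrt_sq_add_sq]
  congr 1
  simp only [Complex.sub_re, Complex.sub_im, Complex.re_ofReal_mul, Complex.im_ofReal_mul,
    Complex.exp_ofReal_mul_I_re, Complex.exp_ofReal_mul_I_im, Real.cos_sub]
  have h1 := Real.sin_sq_add_cos_sq α
  have h2 := Real.sin_sq_add_cos_sq β
  linear_combination r ^ 2 * h1 + s ^ 2 * h2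

theorem coneDist_triangle (p q w : X × ℝ≥0) : coneDist p w ≤ coneDist p q + coneDist q w := by
  obtain ⟨x, r⟩ := p
  obtain ⟨y, s⟩ := q
  obtain ⟨z, t⟩ := w
  set α := min Real.pi (dist x y) with hα
  set β := min Real.pi (dist y z) with hβ
  set γ := min Real.pi (dist x z) with hγ
  have hα0 : 0 ≤ α := le_min Real.pi_pos.le dist_nonneg
  have hβ0 : 0 ≤ β := le_min Real.pi_pos.le dist_nonneg
  have hγ0 : 0 ≤ γ := le_min Real.pi_pos.le dist_nonneg
  have hαπ : α ≤ Real.pi := min_le_left _ _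
  have hβπ : β ≤ Real.pi := min_le_left _ _
  have hγπ : γ ≤ Real.pi := min_le_left _ _
  have hγs : γ ≤ α + β := by
    have := dist_triangle x y z
    rcases min_cases Real.pi (dist x y) with h | h <;>
      rcases min_cases Real.pi (dist y z) with h' | h' <;>
      rcases min_cases Real.pi (dist x z) with h'' | h'' <;>
      linarith
  set δ := min β (Real.pi - α) with hδ
  have hδ0 : 0 ≤ δ := le_min hβ0 (by linarith)
  have hδβ : δ ≤ β := min_le_left _ _
  have hδπ : α + δ ≤ Real.pi := by
    have : δ ≤ Real.pi - α := min_le_right _ _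
    linarith
  have hγδ : γ ≤ α + δ := by
    rcases min_cases β (Real.pi - α) with h | h <;> linarith
  have c1 : Real.cos (α + δ) ≤ Real.cos γ := Real.cos_le_cos_of_nonneg_of_le_pi hγ0 hδπ hγδ
  have c2 : Real.cos β ≤ Real.cos δ := Real.cos_le_cos_of_nonneg_of_le_pi hδ0 hβπ hδβ
  have hr : (0 : ℝ) ≤ r := r.2
  have hs : (0 : ℝ) ≤ s := s.2
  have ht : (0 : ℝ) ≤ t := t.2
  have hrt : 0 ≤ (r : ℝ) * t := mul_nonneg hr ht
  have hst : 0 ≤ (s : ℝ) * t := mul_nonneg hs ht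
  have e1 := norm_polar_sub r s 0 α
  have e2 := norm_polar_sub s t α (α + δ)
  have e3 := norm_polar_sub r t 0 (α + δ)
  have tri := norm_sub_le_norm_sub_add_norm_sub
    ((r : ℂ) * Complex.exp ((0 : ℝ) * Complex.I)) ((s : ℂ) * Complex.exp (α * Complex.I))
    ((t : ℂ) * Complex.exp ((α + δ : ℝ) * Complex.I))
  rw [zero_sub, Real.cos_neg] at e1 e3
  rw [sub_add_cancel_left, Real.cos_neg] at e2
  rw [e1, e2, e3] at tri
  have f1 : coneDist (x, r) (z, t)
      ≤ Real.sqrt ((r : ℝ) ^ 2 + (t : ℝ) ^ 2 - 2 * r * t * Real.cos (α + δ)) := by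
    apply Real.sqrt_le_sqrt
    have := mul_le_mul_of_nonneg_left c1 hrt
    simp only [← hγ]
    linarith
  have f2 : Real.sqrt ((s : ℝ) ^ 2 + (t : ℝ) ^ 2 - 2 * s * t * Real.cos δ)
      ≤ coneDist (y, s) (z, t) := by
    apply Real.sqrt_le_sqrt
    have := mul_le_mul_of_nonneg_left c2 hst
    simp only [← hβ]
    linarith
  have f3 : coneDist (x, r) (y, s)
      = Real.sqrt ((r : ℝ) ^ 2 + (s : ℝ) ^ 2 - 2 * r * s * Real.cos α) := rfl
  linarith

theorem coneSetoid_of_coneDist_eq_zero {p q : X × ℝ≥0} (h : coneDist p q = 0) :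
    (coneSetoid X).r p q := by
  obtain ⟨x, r⟩ := p
  obtain ⟨y, s⟩ := q
  set α := min Real.pi (dist x y) with hα
  have hα0 : 0 ≤ α := le_min Real.pi_pos.le dist_nonneg
  have hαπ : α ≤ Real.pi := min_le_left _ _
  have hr : (0 : ℝ) ≤ r := r.2
  have hs : (0 : ℝ) ≤ s := s.2
  have hrs : 0 ≤ (r : ℝ) * s := mul_nonneg hr hs
  have h1 : 0 ≤ (r : ℝ) * s * (1 - Real.cos α) :=
    mul_nonneg hrs (by linarith [Real.cos_le_one α])
  have h2 : (r : ℝ) ^ 2 + (s : ℝ) ^ 2 - 2 * r * s * Real.cos α ≤ 0 := Real.sqrt_eq_zero'.1 h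
  have h3 : (r : ℝ) = s := by
    have : ((r : ℝ) - s) ^ 2 = 0 := le_antisymm (by nlinarith) (sq_nonneg _)
    have := pow_eq_zero_iff (two_ne_zero) |>.1 this
    linarith
  have h3' : r = s := NNReal.coe_injective h3
  subst h3'
  by_cases h0 : r = 0
  · exact Or.inr ⟨h0, h0⟩
  · left
    have hpos : 0 < (r : ℝ) * r := by positivity
    have h4 : Real.cos α = 1 := by
      have h5 : (r : ℝ) * r * (1 - Real.cos α) ≤ 0 := by nlinarith
      have h6 : 1 - Real.cos α ≤ 0 := by
        by_contra hc
        push Not at hc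
        exact absurd h5 (not_le.2 (mul_pos hpos hc))
      linarith [Real.cos_le_one α]
    have h7 : α = 0 :=
      (Real.cos_eq_one_iff_of_lt_of_lt (by linarith [Real.pi_pos]) (by linarith [Real.pi_pos])).1 h4
    have h8 : dist x y = 0 := by
      rcases min_cases Real.pi (dist x y) with h | h
      · linarith [Real.pi_pos]
      · linarith
    rw [dist_eq_zero.1 h8]

namespace EuclideanCone

/-- The point `(x, t)` of the cone. -/
def mk (x : X) (t : ℝ≥0) : EuclideanCone X := Quotient.mk (coneSetoid X) (x, t)

/-- The cone metric `d ((x, t), (x', t'))² = t² + t'² - 2 t t' cos (min {π, d (x, x')})`. -/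
noncomputable instance : MetricSpace (EuclideanCone X) where
  dist := Quotient.lift₂ (s₁ := coneSetoid X) (s₂ := coneSetoid X) coneDist
    (fun _ _ _ _ h k => coneDist_congr h k)
  dist_self := by
    rintro ⟨p⟩
    exact coneDist_self p
  dist_comm := by
    rintro ⟨p⟩ ⟨q⟩
    exact coneDist_comm p q
  dist_triangle := by
    rintro ⟨p⟩ ⟨q⟩ ⟨w⟩
    exact coneDist_triangle p q w
  eq_of_dist_eq_zero := by
    rintro ⟨p⟩ ⟨q⟩ h
    exact Quotient.sound (s := coneSetoid X) (coneSetoid_of_coneDist_eq_zero h)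

theorem dist_mk (x y : X) (s t : ℝ≥0) :
    dist (mk x s) (mk y t) = Real.sqrt ((s : ℝ) ^ 2 + (t : ℝ) ^ 2
      - 2 * (s : ℝ) * (t : ℝ) * Real.cos (min Real.pi (dist x y))) := rfl

end EuclideanCone

end Cone

/-! ### Geodesics, convex sets, `CAT(0)` spaces and the co-convex topology -/

section Metric

variable {X : Type*} [MetricSpace X]

/-- `γ`, restricted to `[0, 1]`, is a constant speed geodesic from `x` to `y`. -/
def IsGeodesic (γ : ℝ → X) (x y : X) : Prop :=
  γ 0 = x ∧ γ 1 = y ∧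
    ∀ s ∈ Icc (0 : ℝ) 1, ∀ t ∈ Icc (0 : ℝ) 1, dist (γ s) (γ t) = |s - t| * dist x y

/-- A set is convex if it contains every geodesic between any two of its points. -/
def IsGeodesicallyConvex (C : Set X) : Prop :=
  ∀ x ∈ C, ∀ y ∈ C, ∀ γ : ℝ → X, IsGeodesic γ x y → ∀ t ∈ Icc (0 : ℝ) 1, γ t ∈ C

/-- The union of all geodesics between points of `A`. -/
def geodesicJoin (A : Set X) : Set X :=
  {z | ∃ x ∈ A, ∃ y ∈ A, ∃ γ : ℝ → X, IsGeodesic γ x y ∧ ∃ t ∈ Icc (0 : ℝ) 1, γ t = z}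

/-- The convex hull `⋃ₙ Gₙ`, where `G₀ = A` and `Gₙ₊₁` is the union of all geodesics between points
of `Gₙ`. -/
def geodesicHull (A : Set X) : Set X := ⋃ n : ℕ, geodesicJoin^[n] A

/-- The closed convex hull. -/
def closedGeodesicHull (A : Set X) : Set X := closure (geodesicHull A)

variable (X) in
/-- The co-convex topology: the weakest topology that contains the complements of all closed
convex sets. -/
@[reducible] def coconvexTopology : TopologicalSpace X :=
  TopologicalSpace.generateFrom {U | IsClosed Uᶜ ∧ IsGeodesicallyConvex Uᶜ}

variable (X) in
/-- `CAT(0)` spaces: geodesic spaces in which distances between points of a geodesic triangle are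
at most the distances of the corresponding points of a comparison triangle in the Euclidean plane.
Two points on different sides are compared from the common vertex `x` of these sides (for two
points on one side there is nothing to compare). -/
structure IsCAT0 : Prop where
  exists_geodesic : ∀ x y : X, ∃ γ : ℝ → X, IsGeodesic γ x y
  comparison : ∀ (x y z : X) (γ η : ℝ → X), IsGeodesic γ x y → IsGeodesic η x z →
    ∀ x' y' z' : EuclideanSpace ℝ (Fin 2),
      dist x' y' = dist x y → dist y' z' = dist y z → dist x' z' = dist x z →
      ∀ s ∈ Icc (0 : ℝ) 1, ∀ t ∈ Icc (0 : ℝ) 1,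
        dist (γ s) (η t) ≤ dist (AffineMap.lineMap x' y' s) (AffineMap.lineMap x' z' t)

/-- `m` is a midpoint of `x` and `y`. -/
def IsMetricMidpoint (m x y : X) : Prop :=
  dist x m = dist x y / 2 ∧ dist y m = dist x y / 2

/-- The `p`-mean of two non-negative reals, for `p ∈ [1, ∞]`. -/
noncomputable def pMean (p : ℝ≥0∞) (a b : ℝ) : ℝ :=
  if p = ∞ then max a b
  else ((1 / 2) * a ^ p.toReal + (1 / 2) * b ^ p.toReal) ^ (1 / p.toReal)

variable (X) in
/-- Uniform `p`-convexity, for `p ∈ [1, ∞]`. -/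
def IsUniformlyPConvex (p : ℝ≥0∞) : Prop :=
  (∀ x y : X, ∃ m, IsMetricMidpoint m x y) ∧
  ∀ ε : ℝ, 0 < ε → ∃ ρ ∈ Ioo (0 : ℝ) 1, ∀ x y z m : X, IsMetricMidpoint m x y →
    (if p = 1 then |dist x z - dist y z| else 0) + ε * pMean p (dist x z) (dist y z) < dist x y →
      dist m z ≤ (1 - ρ) * pMean p (dist x z) (dist y z)

/-- `x` is the asymptotic center of the sequence `u`: the unique minimizer of
`y ↦ limsup d (y, uₙ)`. -/
def IsAsymptoticCenter (u : ℕ → X) (x : X) : Prop :=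
  ∀ y, y ≠ x → limsup (fun n => edist x (u n)) atTop < limsup (fun n => edist y (u n)) atTop

/-- Weak sequential convergence: `x` is the asymptotic center of every subsequence of `u`. -/
def WeakSeqTendsto (u : ℕ → X) (x : X) : Prop :=
  ∀ φ : ℕ → ℕ, StrictMono φ → IsAsymptoticCenter (u ∘ φ) x

/-- `p` is a nearest point to `x` in the set `C`. -/
def IsNearestPoint (C : Set X) (x p : X) : Prop :=
  p ∈ C ∧ ∀ c ∈ C, dist x p ≤ dist x c

variable (X) in
/-- Property (N), nice projections onto geodesics: if `m` lies on a geodesic from `x` to `y`, then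
the projection of `m` onto a geodesic segment lies on a geodesic between the projections of
`x` and `y`. -/
def HasPropertyN : Prop :=
  ∀ (a b : X) (γ : ℝ → X), IsGeodesic γ a b →
    ∀ (x y : X) (σ : ℝ → X), IsGeodesic σ x y → ∀ t ∈ Icc (0 : ℝ) 1,
      ∀ p q m : X, IsNearestPoint (γ '' Icc 0 1) x p → IsNearestPoint (γ '' Icc 0 1) y q →
        IsNearestPoint (γ '' Icc 0 1) (σ t) m →
          ∃ τ : ℝ → X, IsGeodesic τ p q ∧ ∃ s ∈ Icc (0 : ℝ) 1, τ s = m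

end Metric

/-! ### Metric spaces with the Stewart inequality -/

section Stewart

variable {X Y : Type*} [MetricSpace X] [MetricSpace Y]

/-! All metric statements come from one inequality, Stewart's theorem with `≤`. It makes geodesics
exist and be unique, and used twice it gives the `CAT(0)` comparison. Its midpoint case gives
uniform `p`-convexity. Its parallelogram-type consequence `dist_sq_le_of_infDist` yields nearest
points and, through ultrafilters, compactness of bounded closed convex sets.

For the cone, `t t' cos d` plays the role of an inner product. Stewart's inequality then asks for a
point `(m, ρ)` with `ρ²` equal to the squared length of `a x + b y` and `a cos d(z,x) + b cos d(z,y)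
≤ ρ cos d(z,m)` for all `z` (`exists_cone_combination`). This is an equality on the sphere; for flat
directions it follows by comparing Euclidean with spherical hinges, which rests on the convexity of
`q ↦ cos √q`.

For orthonormal `eₙ`, every closed convex set containing a tail of `(eₙ, 1)` contains two distinct
points of the axis over `0`: the asymptotic center, at radius `cos 1`, and the limit of iterated
midpoints, at radius `∏ cos √(2⁻ⁱ)`, `i ≥ 1`. They differ because `cos 1 < 9/16 ≤ cos² (√2/2)`, and
the last number is a lower bound for the product. Reflections in the hyperplanes orthogonal to the
`eₖ` confine the intersection of the hulls to the axis, so it is a segment. Linear isometries from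
`ℓ²` show that the segment is the same for all orthonormal sequences, in particular for
subsequences; hence its points are exactly the co-convex limits, and the topology is not Hausdorff.
The gap between `cos 1` and `cos² (√2/2)` also refutes property (N). -/

variable (X) in
/-- Any two points are joined by points that satisfy the inequality form of Stewart's theorem. -/
def StewartSpace : Prop :=
  ∀ x y : X, ∀ t ∈ Icc (0 : ℝ) 1, ∃ m : X, ∀ z : X,
    dist z m ^ 2 ≤ (1 - t) * dist z x ^ 2 + t * dist z y ^ 2 - t * (1 - t) * dist x y ^ 2

namespace StewartSpace

/-- At `z = m` the right-hand side of the inequality for the promised point `n` is at most `0`, so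
`m = n`. -/
theorem stewart_of_dist_le (h : StewartSpace X) {x y m : X} {t : ℝ} (ht : t ∈ Icc (0 : ℝ) 1)
    (h1 : dist x m ≤ t * dist x y) (h2 : dist y m ≤ (1 - t) * dist x y) (z : X) :
    dist z m ^ 2 ≤ (1 - t) * dist z x ^ 2 + t * dist z y ^ 2 - t * (1 - t) * dist x y ^ 2 := by
  obtain ⟨n, hn⟩ := h x y t ht
  have h0 := hn m
  rw [dist_comm m x, dist_comm m y] at h0
  have a1 : dist x m ^ 2 ≤ (t * dist x y) ^ 2 := pow_le_pow_left₀ dist_nonneg h1 2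
  have a2 : dist y m ^ 2 ≤ ((1 - t) * dist x y) ^ 2 := pow_le_pow_left₀ dist_nonneg h2 2
  have b1 := mul_le_mul_of_nonneg_left a1 (sub_nonneg.2 ht.2)
  have b2 := mul_le_mul_of_nonneg_left a2 ht.1
  have h3 : dist m n ^ 2 ≤ 0 := by linarith
  have h4 : m = n := dist_eq_zero.1 (pow_eq_zero_iff two_ne_zero |>.1 (le_antisymm h3 (sq_nonneg _)))
  exact h4 ▸ hn z

theorem eq_of_dist_le (h : StewartSpace X) {x y m n : X} {t : ℝ} (ht : t ∈ Icc (0 : ℝ) 1)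
    (h1 : dist x m ≤ t * dist x y) (h2 : dist y m ≤ (1 - t) * dist x y)
    (h3 : dist x n ≤ t * dist x y) (h4 : dist y n ≤ (1 - t) * dist x y) : m = n := by
  have h0 := h.stewart_of_dist_le ht h3 h4 m
  rw [dist_comm m x, dist_comm m y] at h0
  have a1 : dist x m ^ 2 ≤ (t * dist x y) ^ 2 := pow_le_pow_left₀ dist_nonneg h1 2
  have a2 : dist y m ^ 2 ≤ ((1 - t) * dist x y) ^ 2 := pow_le_pow_left₀ dist_nonneg h2 2
  have b1 := mul_le_mul_of_nonneg_left a1 (sub_nonneg.2 ht.2)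
  have b2 := mul_le_mul_of_nonneg_left a2 ht.1
  have h5 : dist m n ^ 2 ≤ 0 := by linarith
  exact dist_eq_zero.1 (pow_eq_zero_iff two_ne_zero |>.1 (le_antisymm h5 (sq_nonneg _)))

end StewartSpace

/-! ### Geodesics. -/

theorem IsGeodesic.dist_left {γ : ℝ → X} {x y : X} (hγ : IsGeodesic γ x y) {t : ℝ}
    (ht : t ∈ Icc (0 : ℝ) 1) : dist x (γ t) = t * dist x y := by
  have := hγ.2.2 0 ⟨le_rfl, zero_le_one⟩ t ht
  rwa [hγ.1, zero_sub, abs_neg, abs_of_nonneg ht.1] at this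

theorem IsGeodesic.dist_right {γ : ℝ → X} {x y : X} (hγ : IsGeodesic γ x y) {t : ℝ}
    (ht : t ∈ Icc (0 : ℝ) 1) : dist y (γ t) = (1 - t) * dist x y := by
  have := hγ.2.2 1 ⟨zero_le_one, le_rfl⟩ t ht
  rwa [hγ.2.1, abs_of_nonneg (sub_nonneg.2 ht.2)] at this

theorem isGeodesic_const (x : X) : IsGeodesic (fun _ => x) x x :=
  ⟨rfl, rfl, by simp⟩

theorem IsGeodesic.eq_of_self {γ : ℝ → X} {x : X} (hγ : IsGeodesic γ x x) {t : ℝ}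
    (ht : t ∈ Icc (0 : ℝ) 1) : γ t = x := by
  have := hγ.dist_left ht
  rw [dist_self, mul_zero] at this
  exact (dist_eq_zero.1 this).symm

theorem IsGeodesic.comp_isometry {f : X → Y} (hf : Isometry f) {γ : ℝ → X} {x y : X}
    (hγ : IsGeodesic γ x y) : IsGeodesic (f ∘ γ) (f x) (f y) := by
  refine ⟨congrArg f hγ.1, congrArg f hγ.2.1, fun s hs t ht => ?_⟩
  simp only [Function.comp_apply, hf.dist_eq]
  exact hγ.2.2 s hs t ht

namespace StewartSpace

theorem stewart (h : StewartSpace X) {γ : ℝ → X} {x y : X} (hγ : IsGeodesic γ x y) {t : ℝ}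
    (ht : t ∈ Icc (0 : ℝ) 1) (z : X) :
    dist z (γ t) ^ 2
      ≤ (1 - t) * dist z x ^ 2 + t * dist z y ^ 2 - t * (1 - t) * dist x y ^ 2 :=
  h.stewart_of_dist_le ht (hγ.dist_left ht).le (hγ.dist_right ht).le z

theorem eq_of_isGeodesic (h : StewartSpace X) {γ : ℝ → X} {x y m : X} (hγ : IsGeodesic γ x y)
    {t : ℝ} (ht : t ∈ Icc (0 : ℝ) 1) (h1 : dist x m ≤ t * dist x y)
    (h2 : dist y m ≤ (1 - t) * dist x y) : γ t = m :=
  h.eq_of_dist_le ht (hγ.dist_left ht).le (hγ.dist_right ht).le h1 h2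

theorem geodesic_unique (h : StewartSpace X) {γ η : ℝ → X} {x y : X} (hγ : IsGeodesic γ x y)
    (hη : IsGeodesic η x y) {t : ℝ} (ht : t ∈ Icc (0 : ℝ) 1) : γ t = η t :=
  h.eq_of_isGeodesic hγ ht (hη.dist_left ht).le (hη.dist_right ht).le

/-- The inequality at `x` and `y` bounds the distances of `γ s` to the ends. At `γ t` it then gives
`dist (γ s) (γ t) ≤ (t - s) dist x y`, and the triangle inequality along `x, γ s, γ t, y` forces
equality. -/
theorem exists_geodesic (h : StewartSpace X) (x y : X) : ∃ γ : ℝ → X, IsGeodesic γ x y := by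
  have : Nonempty X := ⟨x⟩
  choose! γ hγ using h x y
  have key : ∀ s ∈ Icc (0 : ℝ) 1, dist x (γ s) ≤ s * dist x y ∧
      dist y (γ s) ≤ (1 - s) * dist x y := by
    intro s hs
    have h1 := hγ s hs x
    have h2 := hγ s hs y
    rw [dist_self] at h1 h2
    rw [dist_comm y x] at h2
    constructor
    · refine abs_le_of_sq_le_sq' (by nlinarith) (mul_nonneg hs.1 dist_nonneg) |>.2
    · refine abs_le_of_sq_le_sq' (by nlinarith) (mul_nonneg (sub_nonneg.2 hs.2) dist_nonneg) |>.2
  have key2 : ∀ s ∈ Icc (0 : ℝ) 1, ∀ t ∈ Icc (0 : ℝ) 1, s ≤ t →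
      dist (γ s) (γ t) = (t - s) * dist x y := by
    intro s hs t ht hst
    have h1 := hγ s hs (γ t)
    have ks := key s hs
    have kt := key t ht
    rw [dist_comm _ x, dist_comm _ y, dist_comm _ (γ s)] at h1
    have a1 := pow_le_pow_left₀ dist_nonneg kt.1 2
    have a2 := pow_le_pow_left₀ dist_nonneg kt.2 2
    have b1 := mul_le_mul_of_nonneg_left a1 (sub_nonneg.2 hs.2)
    have b2 := mul_le_mul_of_nonneg_left a2 hs.1
    apply le_antisymm
    · refine abs_le_of_sq_le_sq' (by nlinarith) (mul_nonneg (sub_nonneg.2 hst) dist_nonneg) |>.2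
    · have t1 := dist_triangle4 x (γ s) (γ t) y
      rw [dist_comm (γ t) y] at t1
      linarith
  refine ⟨γ, ?_, ?_, ?_⟩
  · have := (key 0 ⟨le_rfl, zero_le_one⟩).1
    rw [zero_mul] at this
    exact (dist_le_zero.1 this).symm
  · have := (key 1 ⟨zero_le_one, le_rfl⟩).2
    rw [sub_self, zero_mul] at this
    exact (dist_le_zero.1 this).symm
  · intro s hs t ht
    rcases le_total s t with hst | hst
    · rw [key2 s hs t ht hst, abs_sub_comm, abs_of_nonneg (sub_nonneg.2 hst)]
    · rw [dist_comm, key2 t ht s hs hst, abs_of_nonneg (sub_nonneg.2 hst)]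

theorem _root_.dist_lineMap_sq {E : Type*} [NormedAddCommGroup E] [InnerProductSpace ℝ E]
    (x y z : E) (t : ℝ) : dist z (AffineMap.lineMap x y t) ^ 2
      = (1 - t) * dist z x ^ 2 + t * dist z y ^ 2 - t * (1 - t) * dist x y ^ 2 := by
  have e1 : z - AffineMap.lineMap x y t = (1 - t) • (z - x) + t • (z - y) := by
    rw [AffineMap.lineMap_apply_module]
    module
  have e2 : x - y = (z - y) - (z - x) := by abel
  simp only [dist_eq_norm]
  rw [e1, e2]
  generalize z - x = u
  generalize z - y = v
  rw [norm_add_sq_real, norm_sub_sq_real, norm_smul, norm_smul, mul_pow, mul_pow, inner_smul_left,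
    inner_smul_right, Real.norm_eq_abs, Real.norm_eq_abs, sq_abs, sq_abs, real_inner_comm]
  simp
  ring

/-- In the plane Stewart's theorem is an equality. The inequality is used for `γ s` seen from `η t`,
then for `η t` seen from `y`. -/
theorem isCAT0 (h : StewartSpace X) : IsCAT0 X := by
  refine ⟨h.exists_geodesic, ?_⟩
  intro x y z γ η hγ hη x' y' z' hxy hyz hxz s hs t ht
  refine abs_le_of_sq_le_sq' ?_ dist_nonneg |>.2
  have h1 := h.stewart hγ hs (η t)
  have h2 := h.stewart hη ht y
  have h3 := hη.dist_left ht
  rw [dist_comm, dist_comm (AffineMap.lineMap x' y' s)]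
  rw [dist_lineMap_sq, dist_comm _ y', dist_lineMap_sq, hxy, hyz, hxz, dist_comm y' x', hxy,
    dist_comm _ x', dist_left_lineMap, hxz, Real.norm_of_nonneg ht.1]
  rw [dist_comm _ x, dist_comm _ y, h3] at h1
  rw [dist_comm y x] at h2
  have := mul_le_mul_of_nonneg_left h2 hs.1
  linarith

/-! #### Convex sets -/

theorem mem_of_isGeodesicallyConvex (h : StewartSpace X) {C : Set X} (hC : IsGeodesicallyConvex C)
    {x y m : X} (hx : x ∈ C) (hy : y ∈ C) {t : ℝ} (ht : t ∈ Icc (0 : ℝ) 1)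
    (h1 : dist x m ≤ t * dist x y) (h2 : dist y m ≤ (1 - t) * dist x y) : m ∈ C := by
  obtain ⟨γ, hγ⟩ := h.exists_geodesic x y
  exact h.eq_of_isGeodesic hγ ht h1 h2 ▸ hC x hx y hy γ hγ t ht

theorem isGeodesicallyConvex_closure (h : StewartSpace X) {C : Set X}
    (hC : IsGeodesicallyConvex C) : IsGeodesicallyConvex (closure C) := by
  intro x hx y hy γ hγ t ht
  obtain ⟨u, hu, hux⟩ := mem_closure_iff_seq_limit.1 hx
  obtain ⟨v, hv, hvy⟩ := mem_closure_iff_seq_limit.1 hy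
  choose η hη using fun n => h.exists_geodesic (u n) (v n)
  refine mem_closure_iff_seq_limit.2 ⟨fun n => η n t,
    fun n => hC _ (hu n) _ (hv n) _ (hη n) t ht, ?_⟩
  -- Stewart's bound on `dist (γ t) (η n t) ^ 2` tends to its value for the endpoints `x`, `y`,
  -- which is `0`.
  have h1 : Tendsto (fun n => (1 - t) * dist (γ t) (u n) ^ 2 + t * dist (γ t) (v n) ^ 2
      - t * (1 - t) * dist (u n) (v n) ^ 2) atTop
      (𝓝 ((1 - t) * dist (γ t) x ^ 2 + t * dist (γ t) y ^ 2 - t * (1 - t) * dist x y ^ 2)) :=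
    (((tendsto_const_nhds.dist hux).pow 2).const_mul _ |>.add
      (((tendsto_const_nhds.dist hvy).pow 2).const_mul _)).sub (((hux.dist hvy).pow 2).const_mul _)
  rw [dist_comm _ x, dist_comm _ y, hγ.dist_left ht, hγ.dist_right ht,
    show (1 - t) * (t * dist x y) ^ 2 + t * ((1 - t) * dist x y) ^ 2
      - t * (1 - t) * dist x y ^ 2 = 0 by ring] at h1
  have h2 : Tendsto (fun n => dist (γ t) (η n t) ^ 2) atTop (𝓝 0) :=
    squeeze_zero (fun _ => sq_nonneg _) (fun n => h.stewart (hη n) ht (γ t)) h1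
  rw [tendsto_iff_dist_tendsto_zero]
  have h3 := h2.sqrt
  simpa [Real.sqrt_sq dist_nonneg, dist_comm] using h3

end StewartSpace

/-! ### Convex hulls. -/

theorem subset_geodesicJoin (A : Set X) : A ⊆ geodesicJoin A :=
  fun x hx => ⟨x, hx, x, hx, _, isGeodesic_const x, 0, ⟨le_rfl, zero_le_one⟩, rfl⟩

theorem subset_geodesicHull (A : Set X) : A ⊆ geodesicHull A :=
  subset_iUnion (fun n => geodesicJoin^[n] A) 0

theorem monotone_iterate_geodesicJoin (A : Set X) : Monotone fun n => geodesicJoin^[n] A :=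
  monotone_nat_of_le_succ fun n => by
    simp only [Function.iterate_succ_apply']
    exact subset_geodesicJoin _

theorem isGeodesicallyConvex_geodesicHull (A : Set X) : IsGeodesicallyConvex (geodesicHull A) := by
  intro x hx y hy γ hγ t ht
  obtain ⟨n, hn⟩ := mem_iUnion.1 hx
  obtain ⟨k, hk⟩ := mem_iUnion.1 hy
  refine mem_iUnion.2 ⟨max n k + 1, ?_⟩
  rw [Function.iterate_succ_apply']
  exact ⟨x, monotone_iterate_geodesicJoin A (le_max_left n k) hn, y,
    monotone_iterate_geodesicJoin A (le_max_right n k) hk, γ, hγ, t, ht, rfl⟩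

theorem geodesicHull_subset {A C : Set X} (hC : IsGeodesicallyConvex C) (hA : A ⊆ C) :
    geodesicHull A ⊆ C := by
  refine iUnion_subset fun n => ?_
  induction n with
  | zero => exact hA
  | succ n ih =>
    rw [Function.iterate_succ_apply']
    rintro _ ⟨x, hx, y, hy, γ, hγ, t, ht, rfl⟩
    exact hC x (ih hx) y (ih hy) γ hγ t ht

theorem closedGeodesicHull_subset {A C : Set X} (hcl : IsClosed C) (hC : IsGeodesicallyConvex C)
    (hA : A ⊆ C) : closedGeodesicHull A ⊆ C :=
  closure_minimal (geodesicHull_subset hC hA) hcl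

theorem subset_closedGeodesicHull (A : Set X) : A ⊆ closedGeodesicHull A :=
  (subset_geodesicHull A).trans subset_closure

theorem isClosed_closedGeodesicHull (A : Set X) : IsClosed (closedGeodesicHull A) :=
  isClosed_closure

theorem IsGeodesicallyConvex.preimage_isometry {f : X → Y} (hf : Isometry f) {C : Set Y}
    (hC : IsGeodesicallyConvex C) : IsGeodesicallyConvex (f ⁻¹' C) :=
  fun x hx y hy _ hγ t ht => hC (f x) hx (f y) hy _ (hγ.comp_isometry hf) t ht

theorem IsGeodesicallyConvex.inter {C D : Set X} (hC : IsGeodesicallyConvex C)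
    (hD : IsGeodesicallyConvex D) : IsGeodesicallyConvex (C ∩ D) :=
  fun x hx y hy γ hγ t ht => ⟨hC x hx.1 y hy.1 γ hγ t ht, hD x hx.2 y hy.2 γ hγ t ht⟩

namespace StewartSpace

theorem isGeodesicallyConvex_closedGeodesicHull (h : StewartSpace X) (A : Set X) :
    IsGeodesicallyConvex (closedGeodesicHull A) :=
  h.isGeodesicallyConvex_closure (isGeodesicallyConvex_geodesicHull A)

theorem isGeodesicallyConvex_image (hX : StewartSpace X) (hY : StewartSpace Y) {f : X → Y}
    (hf : Isometry f) {C : Set X} (hC : IsGeodesicallyConvex C) :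
    IsGeodesicallyConvex (f '' C) := by
  rintro _ ⟨x, hx, rfl⟩ _ ⟨y, hy, rfl⟩ γ hγ t ht
  obtain ⟨η, hη⟩ := hX.exists_geodesic x y
  rw [hY.geodesic_unique hγ (hη.comp_isometry hf) ht]
  exact mem_image_of_mem f (hC x hx y hy η hη t ht)

theorem image_closedGeodesicHull [CompleteSpace X] (hX : StewartSpace X) (hY : StewartSpace Y)
    {f : X → Y} (hf : Isometry f) (A : Set X) :
    f '' closedGeodesicHull A = closedGeodesicHull (f '' A) := by
  apply Subset.antisymm
  · rw [image_subset_iff]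
    exact closedGeodesicHull_subset ((isClosed_closedGeodesicHull _).preimage hf.continuous)
      ((hY.isGeodesicallyConvex_closedGeodesicHull _).preimage_isometry hf)
      (image_subset_iff.1 (subset_closedGeodesicHull _))
  · exact closedGeodesicHull_subset
      (hf.isClosedEmbedding.isClosedMap _ (isClosed_closedGeodesicHull _))
      (hX.isGeodesicallyConvex_image hY hf (hX.isGeodesicallyConvex_closedGeodesicHull _))
      (image_mono (subset_closedGeodesicHull _))

theorem isGeodesicallyConvex_fixedPoints (h : StewartSpace X) {f : X → X} (hf : Isometry f) :
    IsGeodesicallyConvex (Function.fixedPoints f) := by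
  intro x hx y hy γ hγ t ht
  have h1 := hγ.comp_isometry hf
  rw [hx.eq, hy.eq] at h1
  exact h.geodesic_unique h1 hγ ht

theorem isGeodesicallyConvex_closedBall (h : StewartSpace X) (o : X) (r : ℝ) :
    IsGeodesicallyConvex (Metric.closedBall o r) := by
  intro x hx y hy γ hγ t ht
  rw [Metric.mem_closedBall, dist_comm] at hx hy ⊢
  have hr : 0 ≤ r := dist_nonneg.trans hx
  have h1 := h.stewart hγ ht o
  have a1 := mul_le_mul_of_nonneg_left (pow_le_pow_left₀ dist_nonneg hx 2) (sub_nonneg.2 ht.2)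
  have a2 := mul_le_mul_of_nonneg_left (pow_le_pow_left₀ dist_nonneg hy 2) ht.1
  have a3 : 0 ≤ t * (1 - t) * dist x y ^ 2 :=
    mul_nonneg (mul_nonneg ht.1 (sub_nonneg.2 ht.2)) (sq_nonneg _)
  exact abs_le_of_sq_le_sq' (by linarith) hr |>.2

/-! #### Nearest points and compactness -/

/-- Two points of a convex set that almost realize the distance to `o` are close. -/
theorem dist_sq_le_of_infDist (h : StewartSpace X) {K : Set X} (hK : IsGeodesicallyConvex K)
    {o x y : X} (hx : x ∈ K) (hy : y ∈ K) {r s : ℝ} (hr : r ≤ Metric.infDist o K) (hr0 : 0 ≤ r)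
    (hxs : dist o x ≤ s) (hys : dist o y ≤ s) : dist x y ^ 2 ≤ 4 * (s ^ 2 - r ^ 2) := by
  obtain ⟨γ, hγ⟩ := h.exists_geodesic x y
  have ht : (1 / 2 : ℝ) ∈ Icc (0 : ℝ) 1 := by norm_num
  have h1 := h.stewart hγ ht o
  have h2 : r ≤ dist o (γ (1 / 2)) :=
    hr.trans (Metric.infDist_le_dist_of_mem (hK x hx y hy γ hγ _ ht))
  have a1 := pow_le_pow_left₀ dist_nonneg hxs 2
  have a2 := pow_le_pow_left₀ dist_nonneg hys 2
  have a3 := pow_le_pow_left₀ hr0 h2 2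
  linarith

/-- A filter basis of closed convex sets that stay within bounded distance of a point has a common
point. -/
theorem exists_forall_mem [CompleteSpace X] (h : StewartSpace X) (𝒦 : Set (Set X))
    (hne : ∀ K ∈ 𝒦, K.Nonempty) (hcl : ∀ K ∈ 𝒦, IsClosed K)
    (hcv : ∀ K ∈ 𝒦, IsGeodesicallyConvex K) (hinter : ∀ K ∈ 𝒦, ∀ L ∈ 𝒦, K ∩ L ∈ 𝒦)
    (hne' : 𝒦.Nonempty) (o : X) {B : ℝ} (hB : ∀ K ∈ 𝒦, Metric.infDist o K ≤ B) :
    ∃ p, (∀ K ∈ 𝒦, p ∈ K) ∧ dist o p ≤ B := by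
  set T : Set ℝ := (fun K => Metric.infDist o K) '' 𝒦 with hT
  have hTne : T.Nonempty := hne'.image _
  have hTb : BddAbove T := ⟨B, by rintro _ ⟨K, hK, rfl⟩; exact hB K hK⟩
  set r := sSup T with hr
  have hrK : ∀ K ∈ 𝒦, Metric.infDist o K ≤ r := fun K hK => le_csSup hTb ⟨K, hK, rfl⟩
  have hrB : r ≤ B := csSup_le hTne (by rintro _ ⟨K, hK, rfl⟩; exact hB K hK)
  have hr0 : 0 ≤ r := by
    obtain ⟨K, hK⟩ := hne'
    exact Metric.infDist_nonneg.trans (hrK K hK)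
  set δ : ℕ → ℝ := fun n => 1 / ((n : ℝ) + 1) with hδ
  have hδ0 : ∀ n, 0 < δ n := fun n => Nat.one_div_pos_of_nat
  have hδlim : Tendsto δ atTop (𝓝 0) := tendsto_one_div_add_atTop_nhds_zero_nat
  have hδanti : Antitone δ := fun m n hmn => Nat.one_div_le_one_div hmn
  have hL : ∀ n, ∃ K ∈ 𝒦, r - δ n < Metric.infDist o K := by
    intro n
    obtain ⟨_, ⟨K, hK, rfl⟩, hlt⟩ := exists_lt_of_lt_csSup hTne (sub_lt_self r (hδ0 n))
    exact ⟨K, hK, hlt⟩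
  choose L hL𝒦 hLr using hL
  -- Intersecting the first sets makes the family decreasing while its distances to `o` still
  -- approach `r`.
  let N : ℕ → Set X := fun n => Nat.rec (L 0) (fun k S => S ∩ L (k + 1)) n
  have hN : ∀ n, N n ∈ 𝒦 := by
    intro n
    induction n with
    | zero => exact hL𝒦 0
    | succ n ih => exact hinter _ ih _ (hL𝒦 _)
  have hNanti : Antitone N := antitone_nat_of_succ_le fun n => inter_subset_left
  have hNL : ∀ n, N n ⊆ L n := by
    intro n
    cases n with
    | zero => exact Subset.rfl
    | succ n => exact inter_subset_right
  have hNr : ∀ n, max 0 (r - δ n) ≤ Metric.infDist o (N n) := fun n =>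
    max_le Metric.infDist_nonneg
      ((hLr n).le.trans (Metric.infDist_le_infDist_of_subset (hNL n) (hne _ (hN n))))
  -- For fixed `n` the almost nearest points chosen for different `K` all lie in `N n`, hence are
  -- uniformly close. So the sequences for all `K` share one limit.
  have hpick : ∀ K ∈ 𝒦, ∀ n, ∃ q ∈ N n ∩ K, dist o q ≤ r + δ n := by
    intro K hK n
    have hm := hinter _ (hN n) _ hK
    obtain ⟨q, hq, hlt⟩ := (Metric.infDist_lt_iff (hne _ hm)).1
      ((hrK _ hm).trans_lt (lt_add_of_pos_right r (hδ0 n)))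
    exact ⟨q, hq, hlt.le⟩
  have : Nonempty X := ⟨o⟩
  choose! q hq hqr using hpick
  obtain ⟨K₀, hK₀⟩ := hne'
  have hsmall : Tendsto (fun n => 2 * √((r + δ n) ^ 2 - (max 0 (r - δ n)) ^ 2)) atTop (𝓝 0) := by
    have h1 : Tendsto (fun n => 2 * √((r + δ n) ^ 2 - (max 0 (r - δ n)) ^ 2)) atTop
        (𝓝 (2 * √((r + 0) ^ 2 - (max 0 (r - 0)) ^ 2))) :=
      ((((tendsto_const_nhds.add hδlim).pow 2).sub
        ((tendsto_const_nhds.max (tendsto_const_nhds.sub hδlim)).pow 2)).sqrt).const_mul 2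
    simpa [max_eq_right hr0] using h1
  have hdist : ∀ n, ∀ x ∈ N n, ∀ y ∈ N n, dist o x ≤ r + δ n → dist o y ≤ r + δ n →
      dist x y ≤ 2 * √((r + δ n) ^ 2 - (max 0 (r - δ n)) ^ 2) := by
    intro n x hx y hy h1 h2
    have h3 := h.dist_sq_le_of_infDist (hcv _ (hN n)) hx hy (hNr n) (le_max_left _ _) h1 h2
    have h4 := Real.abs_le_sqrt h3
    rw [abs_of_nonneg dist_nonneg, Real.sqrt_mul (by norm_num),
      show (4 : ℝ) = 2 ^ 2 by norm_num, Real.sqrt_sq (by norm_num)] at h4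
    exact h4
  have hcau : CauchySeq (q K₀) := by
    refine cauchySeq_of_le_tendsto_0' _ (fun n m hnm => ?_) hsmall
    exact hdist n _ (hq K₀ hK₀ n).1 _ (hNanti hnm (hq K₀ hK₀ m).1) (hqr K₀ hK₀ n)
      ((hqr K₀ hK₀ m).trans (by linarith [hδanti hnm]))
  obtain ⟨p, hp⟩ := cauchySeq_tendsto_of_complete hcau
  refine ⟨p, fun K hK => ?_, ?_⟩
  · have h1 : Tendsto (q K) atTop (𝓝 p) := by
      refine (tendsto_iff_of_dist ?_).1 hp
      exact squeeze_zero (fun _ => dist_nonneg) (fun n => hdist n _ (hq K₀ hK₀ n).1 _ (hq K hK n).1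
        (hqr K₀ hK₀ n) (hqr K hK n)) hsmall
    exact (hcl K hK).mem_of_tendsto h1 (Eventually.of_forall fun n => (hq K hK n).2)
  · have h1 : Tendsto (fun n => dist o (q K₀ n)) atTop (𝓝 (dist o p)) :=
      tendsto_const_nhds.dist hp
    have h2 : Tendsto (fun n => r + δ n) atTop (𝓝 (r + 0)) := tendsto_const_nhds.add hδlim
    have := le_of_tendsto_of_tendsto' h1 h2 (fun n => hqr K₀ hK₀ n)
    linarith

/-- The closed convex members of an ultrafilter containing `C` all meet `C`, so they have a common
point `p`. A subbasic neighbourhood of `p` outside the ultrafilter would have its closed convex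
complement among these members. -/
theorem isCompact_coconvex [CompleteSpace X] (h : StewartSpace X) {C : Set X}
    (hb : Bornology.IsBounded C) (hcl : IsClosed C) (hC : IsGeodesicallyConvex C) :
    @IsCompact _ (coconvexTopology X) C := by
  rw [@isCompact_iff_ultrafilter_le_nhds]
  intro f hf
  have hCf : C ∈ f := le_principal_iff.1 hf
  obtain ⟨o, ho⟩ := f.nonempty_of_mem hCf
  set 𝒦 : Set (Set X) := {K | IsClosed K ∧ IsGeodesicallyConvex K ∧ K ∈ f} with h𝒦
  obtain ⟨p, hp, -⟩ := h.exists_forall_mem 𝒦 (fun K hK => f.nonempty_of_mem hK.2.2)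
    (fun K hK => hK.1) (fun K hK => hK.2.1)
    (fun K hK L hL => ⟨hK.1.inter hL.1, hK.2.1.inter hL.2.1, inter_mem hK.2.2 hL.2.2⟩)
    ⟨C, hcl, hC, hCf⟩ o (B := Metric.diam C) (by
      intro K hK
      obtain ⟨q, hqK, hqC⟩ := f.nonempty_of_mem (inter_mem hK.2.2 hCf)
      exact (Metric.infDist_le_dist_of_mem hqK).trans (Metric.dist_le_diam_of_mem hb ho hqC))
  refine ⟨p, hp C ⟨hcl, hC, hCf⟩, ?_⟩
  rw [TopologicalSpace.nhds_generateFrom]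
  refine le_iInf₂ fun U hU => le_principal_iff.2 ?_
  by_contra hUf
  exact hp Uᶜ ⟨hU.2.1, hU.2.2, Ultrafilter.compl_mem_iff_notMem.2 hUf⟩ hU.1

theorem exists_isNearestPoint [CompleteSpace X] (h : StewartSpace X) {C : Set X}
    (hne : C.Nonempty) (hcl : IsClosed C) (hC : IsGeodesicallyConvex C) (o : X) :
    ∃ p, IsNearestPoint C o p := by
  obtain ⟨p, hp, hle⟩ := h.exists_forall_mem {C} (by simpa) (by simpa) (by simpa) (by simp)
    ⟨C, rfl⟩ o (B := Metric.infDist o C) (by simp)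
  exact ⟨p, hp C rfl, fun c hc => hle.trans (Metric.infDist_le_dist_of_mem hc)⟩

/-- The angle at a projection is at least a right angle: `p` is compared with the points near it on
the geodesic to `c`, and `t → 0`. -/
theorem sq_add_sq_le_of_isNearestPoint (h : StewartSpace X) {C : Set X}
    (hC : IsGeodesicallyConvex C) {o p c : X} (hp : IsNearestPoint C o p) (hc : c ∈ C) :
    dist o p ^ 2 + dist p c ^ 2 ≤ dist o c ^ 2 := by
  obtain ⟨γ, hγ⟩ := h.exists_geodesic p c
  have key : ∀ t ∈ Ioo (0 : ℝ) 1, dist o p ^ 2 + (1 - t) * dist p c ^ 2 ≤ dist o c ^ 2 := by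
    intro t ht
    have ht' : t ∈ Icc (0 : ℝ) 1 := ⟨ht.1.le, ht.2.le⟩
    have h1 := h.stewart hγ ht' o
    have h2 := pow_le_pow_left₀ dist_nonneg (hp.2 _ (hC p hp.1 c hc γ hγ t ht')) 2
    have h3 : t * (dist o p ^ 2 + (1 - t) * dist p c ^ 2) ≤ t * dist o c ^ 2 := by linarith
    exact le_of_mul_le_mul_left h3 ht.1
  have h1 : Tendsto (fun t : ℝ => dist o p ^ 2 + (1 - t) * dist p c ^ 2) (𝓝[>] 0)
      (𝓝 (dist o p ^ 2 + (1 - 0) * dist p c ^ 2)) :=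
    tendsto_nhdsWithin_of_tendsto_nhds
      (Continuous.tendsto (by fun_prop : Continuous fun t : ℝ =>
        dist o p ^ 2 + (1 - t) * dist p c ^ 2) 0)
  have h2 := le_of_tendsto h1 (by
    filter_upwards [Ioo_mem_nhdsGT (zero_lt_one' ℝ)] with t ht using key t ht)
  linarith

end StewartSpace

end Stewart

/-! ### The Euclidean cone -/

namespace EuclideanCone

section Basic

variable {X Y : Type*}

theorem exists_eq_mk (p : EuclideanCone X) : ∃ (x : X) (t : ℝ≥0), p = mk x t :=
  Quotient.inductionOn p fun q => ⟨q.1, q.2, rfl⟩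

theorem mk_zero (x y : X) : mk x 0 = mk y 0 :=
  Quotient.sound (s := coneSetoid X) (Or.inr ⟨rfl, rfl⟩)

theorem mk_eq_mk {x y : X} {s t : ℝ≥0} (h : mk x s = mk y t) : s = t ∧ (s ≠ 0 → x = y) := by
  rcases Quotient.exact (s := coneSetoid X) h with h | ⟨h, h'⟩
  · cases h
    exact ⟨rfl, fun _ => rfl⟩
  · exact ⟨h.trans h'.symm, fun h0 => absurd h h0⟩

/-- The map of cones induced by an isometry. -/
def map (f : X → Y) : EuclideanCone X → EuclideanCone Y :=
  Quotient.map (sa := coneSetoid X) (sb := coneSetoid Y) (fun p => (f p.1, p.2)) (by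
    rintro p q (rfl | h)
    · exact Or.inl rfl
    · exact Or.inr h)

theorem map_mk (f : X → Y) (x : X) (t : ℝ≥0) : map f (mk x t) = mk (f x) t := rfl

variable [MetricSpace X] [MetricSpace Y]

theorem dist_mk_sq (x y : X) (s t : ℝ≥0) :
    dist (mk x s) (mk y t) ^ 2 = (s : ℝ) ^ 2 + (t : ℝ) ^ 2
      - 2 * (s : ℝ) * (t : ℝ) * Real.cos (min Real.pi (dist x y)) := by
  rw [dist_mk, Real.sq_sqrt]
  have h1 : 0 ≤ (s : ℝ) * t * (1 - Real.cos (min Real.pi (dist x y))) :=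
    mul_nonneg (mul_nonneg s.2 t.2) (by linarith [Real.cos_le_one (min Real.pi (dist x y))])
  nlinarith [sq_nonneg ((s : ℝ) - t)]

theorem dist_mk_zero (x y : X) (t : ℝ≥0) : dist (mk x 0) (mk y t) = t := by
  rw [dist_mk]
  simp

theorem dist_mk_same (x : X) (s t : ℝ≥0) : dist (mk x s) (mk x t) = |(s : ℝ) - t| := by
  rw [dist_mk, dist_self, min_eq_right Real.pi_pos.le, Real.cos_zero, ← Real.sqrt_sq_eq_abs]
  congr 1
  ring

theorem continuous_mk : Continuous fun p : X × ℝ≥0 => mk p.1 p.2 := by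
  refine continuous_iff_continuousAt.2 fun ⟨x, t⟩ => ?_
  rw [ContinuousAt, tendsto_iff_dist_tendsto_zero]
  simp only [dist_mk]
  have h : Continuous fun p : X × ℝ≥0 => Real.sqrt ((p.2 : ℝ) ^ 2 + (t : ℝ) ^ 2
      - 2 * (p.2 : ℝ) * (t : ℝ) * Real.cos (min Real.pi (dist p.1 x))) := by fun_prop
  have h1 := h.tendsto (x, t)
  simp only [dist_self, min_eq_right Real.pi_pos.le, Real.cos_zero] at h1
  rwa [show (t : ℝ) ^ 2 + (t : ℝ) ^ 2 - 2 * (t : ℝ) * (t : ℝ) * 1 = 0 by ring,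
    Real.sqrt_zero] at h1

/-- Directions of close points that stay away from the apex are close. -/
theorem dist_le_of_dist_mk_lt {x y : X} {s t : ℝ≥0} {c : ℝ} (hc : 0 < c) (hs : c ≤ s)
    (ht : c ≤ t) (hd : dist (mk x s) (mk y t) < 2 * c) :
    dist x y ≤ Real.pi / (2 * c) * dist (mk x s) (mk y t) := by
  have h1 := dist_mk_sq x y s t
  set θ := min Real.pi (dist x y) with hθ
  have hθ0 : 0 ≤ θ := le_min Real.pi_pos.le dist_nonneg
  have hθπ : θ ≤ Real.pi := min_le_left _ _
  have h2 := Real.cos_le_one_sub_mul_cos_sq (abs_le.2 ⟨by linarith [Real.pi_pos], hθπ⟩)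
  have h3 : c * c ≤ s * t := mul_le_mul hs ht hc.le s.2
  have h4 : 0 ≤ 2 / Real.pi ^ 2 * θ ^ 2 := by positivity
  have h5 : (2 * c / Real.pi * θ) ^ 2 ≤ dist (mk x s) (mk y t) ^ 2 := by
    have a1 := mul_le_mul_of_nonneg_right h3 h4
    have a2 := mul_le_mul_of_nonneg_left h2 (mul_nonneg s.2 t.2)
    have a3 : (2 * c / Real.pi * θ) ^ 2 = 2 * (c * c * (2 / Real.pi ^ 2 * θ ^ 2)) := by ring
    change (s : ℝ) * t * _ ≤ (s : ℝ) * t * _ at a2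
    nlinarith [sq_nonneg ((s : ℝ) - t)]
  have h6 := (abs_le_of_sq_le_sq' h5 dist_nonneg).2
  have h7 : θ ≤ Real.pi / (2 * c) * dist (mk x s) (mk y t) := by
    have := mul_le_mul_of_nonneg_left h6 (by positivity : 0 ≤ Real.pi / (2 * c))
    have e : Real.pi / (2 * c) * (2 * c / Real.pi * θ) = θ := by
      field_simp
    rwa [e] at this
  have h8 : Real.pi / (2 * c) * dist (mk x s) (mk y t) < Real.pi := by
    have := mul_lt_mul_of_pos_left hd (by positivity : 0 < Real.pi / (2 * c))
    rwa [div_mul_cancel₀ _ (by positivity)] at this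
  have h9 : θ = dist x y := by
    rcases min_choice Real.pi (dist x y) with h | h
    · linarith
    · exact h
  exact h9 ▸ h7

/-- Radii are distances to the apex, so they converge. Limit `0` means convergence to the apex;
otherwise the radii eventually exceed `T / 2` and the directions are Cauchy too. -/
instance [CompleteSpace X] : CompleteSpace (EuclideanCone X) := by
  refine Metric.complete_of_cauchySeq_tendsto fun u hu => ?_
  choose x t hxt using fun n => exists_eq_mk (u n)
  have ht : ∀ n, dist (mk (x 0) 0) (u n) = t n := fun n => by rw [hxt, dist_mk_zero]
  obtain ⟨T, hT⟩ := cauchySeq_tendsto_of_complete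
    ((uniformContinuous_const (b := mk (x 0) 0)).dist uniformContinuous_id |>.comp_cauchySeq hu)
  simp only [Function.comp_def, id, ht] at hT
  have hT0 : 0 ≤ T := ge_of_tendsto' hT fun n => (t n).2
  lift T to ℝ≥0 using hT0
  rcases eq_zero_or_pos T with rfl | hTpos
  · refine ⟨mk (x 0) 0, tendsto_iff_dist_tendsto_zero.2 ?_⟩
    simpa only [dist_comm _ (mk (x 0) 0), ht, NNReal.coe_zero] using hT
  · have hc : (0 : ℝ) < T / 2 := half_pos (NNReal.coe_pos.2 hTpos)
    obtain ⟨N₀, hN₀⟩ := eventually_atTop.1 (hT.eventually (lt_mem_nhds (half_lt_self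
      (NNReal.coe_pos.2 hTpos))))
    have hx : CauchySeq x := by
      refine Metric.cauchySeq_iff.2 fun ε hε => ?_
      have hK : 0 < Real.pi / (2 * ((T : ℝ) / 2)) := div_pos Real.pi_pos (by linarith)
      obtain ⟨N, hN⟩ := Metric.cauchySeq_iff.1 hu
        (min (2 * (T / 2)) (ε / (Real.pi / (2 * ((T : ℝ) / 2)))))
        (lt_min (by linarith) (div_pos hε hK))
      refine ⟨max N N₀, fun m hm n hn => ?_⟩
      have h1 := hN m (le_of_max_le_left hm) n (le_of_max_le_left hn)
      rw [hxt m, hxt n] at h1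
      refine (dist_le_of_dist_mk_lt hc (hN₀ m (le_of_max_le_right hm)).le
        (hN₀ n (le_of_max_le_right hn)).le (h1.trans_le (min_le_left _ _))).trans_lt ?_
      have := mul_lt_mul_of_pos_left (h1.trans_le (min_le_right _ _)) hK
      rwa [mul_div_cancel₀ _ hK.ne'] at this
    obtain ⟨x₀, hx₀⟩ := cauchySeq_tendsto_of_complete hx
    refine ⟨mk x₀ T, ?_⟩
    have := (continuous_mk.tendsto (x₀, T)).comp
      (hx₀.prodMk_nhds (NNReal.tendsto_coe.1 hT))
    exact this.congr fun n => (hxt n).symm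

theorem isometry_map {f : X → Y} (hf : Isometry f) : Isometry (map f) := by
  refine Isometry.of_dist_eq fun p q => ?_
  obtain ⟨x, s, rfl⟩ := exists_eq_mk p
  obtain ⟨y, t, rfl⟩ := exists_eq_mk q
  rw [map_mk, map_mk, dist_mk, dist_mk, hf.dist_eq]

end Basic

end EuclideanCone

/-! ### Comparison with the sphere -/

section Comparison

theorem mul_sin_le_mul_sin {a b : ℝ} (ha : 0 ≤ a) (hab : a ≤ b) (hb : b ≤ Real.pi) :
    a * Real.sin b ≤ b * Real.sin a := by
  rcases (ha.trans hab).eq_or_lt with h | hb0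
  · rw [← h] at hab ⊢
    simp [le_antisymm hab ha]
  have h1 := strictConcaveOn_sin_Icc.concaveOn.2 (left_mem_Icc.2 Real.pi_pos.le)
    (show b ∈ Icc 0 Real.pi from ⟨hb0.le, hb⟩) (sub_nonneg.2 ((div_le_one hb0).2 hab))
    (div_nonneg ha hb0.le) (by ring)
  simp only [smul_eq_mul, mul_zero, zero_add, Real.sin_zero] at h1
  rw [div_mul_cancel₀ _ hb0.ne'] at h1
  have h2 := mul_le_mul_of_nonneg_left h1 hb0.le
  rwa [← mul_assoc, mul_div_cancel₀ _ hb0.ne'] at h2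

/-- The derivative `-sin √q / (2 √q)` increases because `sin u / u` decreases on `(0, π]`. -/
theorem convexOn_cos_sqrt : ConvexOn ℝ (Icc 0 (Real.pi ^ 2)) fun q => Real.cos √q := by
  have hd : ∀ q ∈ interior (Icc 0 (Real.pi ^ 2)),
      HasDerivAt (fun q => Real.cos √q) (-Real.sin √q * (1 / (2 * √q))) q := by
    intro q hq
    rw [interior_Icc] at hq
    exact (Real.hasDerivAt_sqrt hq.1.ne').cos
  refine MonotoneOn.convexOn_of_deriv (convex_Icc _ _) (by fun_prop)
    (fun q hq => (hd q hq).differentiableAt.differentiableWithinAt) ?_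
  intro p hp q hq hpq
  rw [(hd p hp).deriv, (hd q hq).deriv]
  rw [interior_Icc] at hp hq
  have hp0 := Real.sqrt_pos.2 hp.1
  have hq0 := Real.sqrt_pos.2 hq.1
  have hqπ : √q ≤ Real.pi := Real.sqrt_le_iff.2 ⟨Real.pi_pos.le, hq.2.le⟩
  have h := mul_sin_le_mul_sin hp0.le (Real.sqrt_le_sqrt hpq) hqπ
  rw [mul_one_div, mul_one_div, div_le_div_iff₀ (by linarith) (by linarith)]
  linarith

/-- The third side of a Euclidean hinge is at least as long as that of the spherical hinge with the
same sides and the same angle. -/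
theorem cos_min_sqrt_le {D δ c : ℝ} (hD : D ∈ Icc 0 Real.pi) (hδ : δ ∈ Icc 0 Real.pi)
    (hc : c ∈ Icc (-1 : ℝ) 1) :
    Real.cos (min Real.pi √(D ^ 2 + δ ^ 2 - 2 * D * δ * c))
      ≤ Real.cos D * Real.cos δ + c * (Real.sin D * Real.sin δ) := by
  set q := D ^ 2 + δ ^ 2 - 2 * D * δ * c with hq
  -- Both `q` and the right-hand side are affine in `c`. They are interpolated between the
  -- degenerate hinges `c = 1` and `c = -1`, with third sides `|D - δ|` and `D + δ`.
  set l := (1 - c) / 2 with hl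
  have hl0 : 0 ≤ l := by linarith [hc.2]
  have hl1 : 0 ≤ 1 - l := by linarith [hc.1]
  have hrhs : Real.cos D * Real.cos δ + c * (Real.sin D * Real.sin δ)
      = (1 - l) * Real.cos (D - δ) + l * Real.cos (D + δ) := by
    rw [Real.cos_sub, Real.cos_add]
    ring
  have hq2 : q = (1 - l) * (D - δ) ^ 2 + l * (D + δ) ^ 2 := by ring
  have hπ := Real.pi_pos
  have habs : |D - δ| ≤ Real.pi := abs_le.2 ⟨by linarith [hD.1, hδ.2], by linarith [hD.2, hδ.1]⟩
  have hm0 : (D - δ) ^ 2 ∈ Icc 0 (Real.pi ^ 2) :=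
    ⟨sq_nonneg _, sq_le_sq.2 (by rwa [abs_of_pos hπ])⟩
  have hf0 : Real.cos √((D - δ) ^ 2) = Real.cos (D - δ) := by
    rw [Real.sqrt_sq_eq_abs, Real.cos_abs]
  rw [hrhs]
  rcases le_total (D + δ) Real.pi with h | h
  · have hm1 : (D + δ) ^ 2 ∈ Icc 0 (Real.pi ^ 2) :=
      ⟨sq_nonneg _, pow_le_pow_left₀ (add_nonneg hD.1 hδ.1) h 2⟩
    have h1 := convexOn_cos_sqrt.2 hm0 hm1 hl1 hl0 (by ring)
    have h2 := (convex_Icc 0 (Real.pi ^ 2)) hm0 hm1 hl1 hl0 (by ring)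
    simp only [smul_eq_mul] at h1 h2
    rw [← hq2, hf0, Real.sqrt_sq (add_nonneg hD.1 hδ.1)] at h1
    rw [← hq2] at h2
    rwa [min_eq_right (Real.sqrt_le_iff.2 ⟨hπ.le, h2.2⟩)]
  -- Now `(D + δ) ^ 2` may lie beyond the interval of convexity. It is replaced by `π ^ 2`, where
  -- the cosine is least; this only raises the weight of that end, from `l` to `μ`.
  · have c1 := Real.neg_one_le_cos (D - δ)
    have c2 := Real.neg_one_le_cos (D + δ)
    have d1 := mul_le_mul_of_nonneg_left c1 hl1
    have d2 := mul_le_mul_of_nonneg_left c2 hl0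
    rcases le_or_gt (Real.pi ^ 2) q with hqπ | hqπ
    · rw [min_eq_left (Real.le_sqrt_of_sq_le hqπ), Real.cos_pi]
      linarith
    · have hDδ : 0 ≤ D * δ := mul_nonneg hD.1 hδ.1
      have hq0 : (D - δ) ^ 2 ≤ q := by nlinarith [hc.2]
      have hq1 : Real.pi ^ 2 ≤ (D + δ) ^ 2 := pow_le_pow_left₀ hπ.le h 2
      have hpos : 0 < Real.pi ^ 2 - (D - δ) ^ 2 := by linarith
      set μ := (q - (D - δ) ^ 2) / (Real.pi ^ 2 - (D - δ) ^ 2) with hμ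
      have hμ0 : 0 ≤ μ := div_nonneg (by linarith) hpos.le
      have hμ1 : 0 ≤ 1 - μ := sub_nonneg.2 ((div_le_one hpos).2 (by linarith))
      have hμq : μ * (Real.pi ^ 2 - (D - δ) ^ 2) = q - (D - δ) ^ 2 := div_mul_cancel₀ _ hpos.ne'
      have hlμ : l ≤ μ := by
        rw [hμ, le_div_iff₀ hpos]
        have := mul_le_mul_of_nonneg_left hq1 hl0
        linarith
      have h1 := convexOn_cos_sqrt.2 hm0 (right_mem_Icc.2 (sq_nonneg Real.pi)) hμ1 hμ0 (by ring)
      simp only [smul_eq_mul] at h1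
      rw [show (1 - μ) * (D - δ) ^ 2 + μ * Real.pi ^ 2 = q by linarith, hf0, Real.sqrt_sq hπ.le,
        Real.cos_pi] at h1
      rw [min_eq_right (Real.sqrt_le_iff.2 ⟨hπ.le, hqπ.le⟩)]
      have := mul_le_mul_of_nonneg_left c1 (sub_nonneg.2 hlμ)
      linarith

variable {E : Type*} [NormedAddCommGroup E] [InnerProductSpace ℝ E]

/-- This is the hinge at `m` with sides towards `z` and along `e`. If `z` is at distance at least
`π`, the sine vanishes and the triangle inequality suffices; if `z = m`, the quotient is `0 / 0 =
0`, which is harmless. -/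
theorem cos_min_dist_add_smul_le (m z : E) {e : E} (he : ‖e‖ = 1) {δ : ℝ}
    (hδ : δ ∈ Icc 0 Real.pi) :
    Real.cos (min Real.pi (dist z (m + δ • e)))
      ≤ Real.cos (min Real.pi (dist z m)) * Real.cos δ
        + inner ℝ (z - m) e / ‖z - m‖ * (Real.sin (min Real.pi (dist z m)) * Real.sin δ) := by
  rcases le_or_gt Real.pi (dist z m) with h | h
  · rw [min_eq_left h, Real.cos_pi, Real.sin_pi, zero_mul, mul_zero, add_zero, neg_one_mul,
      ← Real.cos_pi_sub]
    refine Real.cos_le_cos_of_nonneg_of_le_pi (sub_nonneg.2 hδ.2) (min_le_left _ _)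
      (le_min (by linarith [hδ.1]) ?_)
    have h1 := dist_triangle z (m + δ • e) m
    rw [dist_self_add_left, norm_smul, he, Real.norm_of_nonneg hδ.1] at h1
    linarith
  · rw [min_eq_right h.le]
    have hc : |inner ℝ (z - m) e / ‖z - m‖| ≤ 1 := by
      have := abs_real_inner_div_norm_mul_norm_le_one (z - m) e
      rwa [he, mul_one] at this
    have h1 := cos_min_sqrt_le (show dist z m ∈ Icc 0 Real.pi from ⟨dist_nonneg, h.le⟩) hδ (abs_le.1 hc)
    have hin : dist z m * (inner ℝ (z - m) e / ‖z - m‖) = inner ℝ (z - m) e := by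
      rw [dist_eq_norm]
      rcases eq_or_ne ‖z - m‖ 0 with h0 | h0
      · rw [h0, norm_eq_zero.1 h0, inner_zero_left, zero_mul]
      · exact mul_div_cancel₀ _ h0
    have hsq : dist z (m + δ • e) ^ 2 = dist z m ^ 2 + δ ^ 2
        - 2 * dist z m * δ * (inner ℝ (z - m) e / ‖z - m‖) := by
      rw [show 2 * dist z m * δ * (inner ℝ (z - m) e / ‖z - m‖)
        = 2 * δ * (dist z m * (inner ℝ (z - m) e / ‖z - m‖)) by ring, hin, dist_eq_norm,
        dist_eq_norm, ← sub_sub, norm_sub_sq_real, norm_smul, he, inner_smul_right,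
        Real.norm_of_nonneg hδ.1]
      ring
    rwa [← hsq, Real.sqrt_sq dist_nonneg] at h1

/-- Polar coordinates of a vector in a sector. -/
theorem exists_polar {a b θ : ℝ} (ha : 0 ≤ a) (hb : 0 ≤ b) (hθ0 : 0 ≤ θ) (hθ : θ < Real.pi) :
    ∃ ρ ψ : ℝ, 0 ≤ ρ ∧ 0 ≤ ψ ∧ ψ ≤ θ ∧ ρ * Real.cos ψ = a + b * Real.cos θ ∧
      ρ * Real.sin ψ = b * Real.sin θ := by
  have hs : 0 ≤ Real.sin θ := Real.sin_nonneg_of_nonneg_of_le_pi hθ0 hθ.le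
  set w : ℂ := ⟨a + b * Real.cos θ, b * Real.sin θ⟩ with hw
  have hre : ‖w‖ * Real.cos w.arg = a + b * Real.cos θ := Complex.norm_mul_cos_arg w
  have him : ‖w‖ * Real.sin w.arg = b * Real.sin θ := Complex.norm_mul_sin_arg w
  have harg0 : 0 ≤ w.arg := Complex.arg_nonneg_iff.2 (mul_nonneg hb hs)
  refine ⟨‖w‖, w.arg, norm_nonneg _, harg0, ?_, hre, him⟩
  rcases eq_or_ne w 0 with h0 | h0
  · rwa [h0, Complex.arg_zero]
  by_contra! hlt
  have hn : 0 < ‖w‖ := norm_pos_iff.2 h0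
  have h1 : ‖w‖ * Real.sin (w.arg - θ) = -(a * Real.sin θ) := by
    rw [Real.sin_sub]
    linear_combination Real.cos θ * him - Real.sin θ * hre
  have h2 : Real.sin (w.arg - θ) ≤ 0 := by
    by_contra! h3
    linarith [mul_pos hn h3, mul_nonneg ha hs]
  rcases (Complex.arg_le_pi w).lt_or_eq with h3 | h3
  · linarith [Real.sin_pos_of_pos_of_lt_pi (sub_pos.2 hlt) (by linarith)]
  · rw [h3, Real.sin_pi_sub] at h2
    have h4 : θ = 0 := by
      by_contra h5
      linarith [Real.sin_pos_of_pos_of_lt_pi (lt_of_le_of_ne hθ0 (Ne.symm h5)) hθ]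
    rw [h3, h4, Real.cos_pi, Real.cos_zero] at hre
    linarith

/-- The point of the cone that represents `a x + b y`. -/
theorem exists_cone_combination (x y : E) {a b : ℝ} (ha : 0 ≤ a) (hb : 0 ≤ b) :
    ∃ (m : E) (ρ : ℝ), 0 ≤ ρ ∧
      ρ ^ 2 = a ^ 2 + b ^ 2 + 2 * a * b * Real.cos (min Real.pi (dist x y)) ∧
      ∀ z, a * Real.cos (min Real.pi (dist z x)) + b * Real.cos (min Real.pi (dist z y))
        ≤ ρ * Real.cos (min Real.pi (dist z m)) := by
  -- Directions at distance at least `π` count as opposite: the difference of the radii remains, on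
  -- the side of the larger one.
  rcases le_or_gt Real.pi (dist x y) with h | h
  · rw [min_eq_left h, Real.cos_pi]
    have key : ∀ z, Real.cos (min Real.pi (dist z x)) + Real.cos (min Real.pi (dist z y)) ≤ 0 := by
      intro z
      have h1 := dist_triangle_left x y z
      have h2 : Real.cos (min Real.pi (dist z x)) ≤ Real.cos (Real.pi - min Real.pi (dist z y)) := by
        refine Real.cos_le_cos_of_nonneg_of_le_pi (sub_nonneg.2 (min_le_left _ _)) (min_le_left _ _)
          ?_
        rcases min_choice Real.pi (dist z x) with h3 | h3 <;>
          rcases min_choice Real.pi (dist z y) with h4 | h4 <;> rw [h3, h4] <;>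
          linarith [Real.pi_pos, dist_nonneg (x := z) (y := x), dist_nonneg (x := z) (y := y)]
      rw [Real.cos_pi_sub] at h2
      linarith
    rcases le_total b a with hab | hab
    · refine ⟨x, a - b, sub_nonneg.2 hab, ?_, fun z => ?_⟩
      · ring
      · have := mul_le_mul_of_nonneg_left (key z) hb
        linarith
    · refine ⟨y, b - a, sub_nonneg.2 hab, ?_, fun z => ?_⟩
      · ring
      · have := mul_le_mul_of_nonneg_left (key z) ha
        linarith
  · rw [min_eq_right h.le]
    rcases eq_or_ne x y with rfl | hxy
    · refine ⟨x, a + b, add_nonneg ha hb, ?_, fun z => ?_⟩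
      · simp only [dist_self, Real.cos_zero]
        ring
      · exact (add_mul _ _ _).ge
    · set θ := dist x y with hθ
      have hθ0 : 0 < θ := dist_pos.2 hxy
      obtain ⟨ρ, ψ, hρ, hψ0, hψθ, hc, hs⟩ := exists_polar ha hb hθ0.le h
      set e : E := θ⁻¹ • (y - x) with he
      have hnyx : ‖y - x‖ = θ := by rw [hθ, dist_comm, dist_eq_norm]
      have hne : ‖e‖ = 1 := by
        rw [he, norm_smul, hnyx, norm_inv, Real.norm_of_nonneg hθ0.le, inv_mul_cancel₀ hθ0.ne']
      have hθe : θ • e = y - x := by rw [he, smul_smul, mul_inv_cancel₀ hθ0.ne', one_smul]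
      refine ⟨x + ψ • e, ρ, hρ, ?_, fun z => ?_⟩
      · linear_combination (ρ * Real.cos ψ + (a + b * Real.cos θ)) * hc
          + (ρ * Real.sin ψ + b * Real.sin θ) * hs
          - ρ ^ 2 * Real.sin_sq_add_cos_sq ψ + b ^ 2 * Real.sin_sq_add_cos_sq θ
      -- The hinges at `m` towards `x` and `y` have opposite directions `-e` and `e`. The choice of
      -- `ψ` makes their sine terms cancel (`e2`) and the cosine terms add up to `ρ` (`e1`).
      · have h1 := cos_min_dist_add_smul_le (x + ψ • e) z (e := -e) (by rw [norm_neg, hne])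
          (δ := ψ) ⟨hψ0, hψθ.trans h.le⟩
        have h2 := cos_min_dist_add_smul_le (x + ψ • e) z hne (δ := θ - ψ)
          ⟨sub_nonneg.2 hψθ, by linarith⟩
        rw [show x + ψ • e + ψ • -e = x by module, inner_neg_right, neg_div] at h1
        rw [show x + ψ • e + (θ - ψ) • e = x + θ • e by module, hθe, add_sub_cancel] at h2
        have h3 := mul_le_mul_of_nonneg_left h1 ha
        have h4 := mul_le_mul_of_nonneg_left h2 hb
        set D := min Real.pi (dist z (x + ψ • e))
        set k := inner ℝ (z - (x + ψ • e)) e / ‖z - (x + ψ • e)‖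
        have e1 : a * Real.cos ψ + b * Real.cos (θ - ψ) = ρ := by
          rw [Real.cos_sub]
          linear_combination -Real.cos ψ * hc - Real.sin ψ * hs
            + ρ * Real.sin_sq_add_cos_sq ψ
        have e2 : a * Real.sin ψ - b * Real.sin (θ - ψ) = 0 := by
          rw [Real.sin_sub]
          linear_combination -Real.sin ψ * hc + Real.cos ψ * hs
        refine (add_le_add h3 h4).trans (le_of_eq ?_)
        linear_combination Real.cos D * e1 - k * Real.sin D * e2

theorem stewartSpace_of_innerProductSpace : StewartSpace E :=
  fun x y t _ => ⟨AffineMap.lineMap x y t, fun z => (dist_lineMap_sq x y z t).le⟩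

theorem EuclideanCone.stewartSpace : StewartSpace (EuclideanCone E) := by
  intro p q τ hτ
  obtain ⟨x, r, rfl⟩ := exists_eq_mk p
  obtain ⟨y, s, rfl⟩ := exists_eq_mk q
  obtain ⟨m, ρ, hρ0, hρ, hm⟩ := exists_cone_combination x y
    (mul_nonneg (sub_nonneg.2 hτ.2) r.2) (mul_nonneg hτ.1 s.2)
  lift ρ to ℝ≥0 using hρ0
  refine ⟨mk m ρ, fun w => ?_⟩
  obtain ⟨z, t, rfl⟩ := exists_eq_mk w
  have h1 := mul_le_mul_of_nonneg_left (hm z) t.2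
  simp only [NNReal.val_eq_coe] at h1 hρ
  rw [dist_mk_sq, dist_mk_sq, dist_mk_sq, dist_mk_sq, hρ]
  linarith

theorem EuclideanCone.midpoint_dist {x y : E} (h : dist x y ≤ Real.pi) (r : ℝ≥0) {ρ : ℝ≥0}
    (hρ : (ρ : ℝ) = r * Real.cos (dist x y / 2)) :
    dist (mk x r) (mk (midpoint ℝ x y) ρ) ≤ 1 / 2 * dist (mk x r) (mk y r) ∧
    dist (mk y r) (mk (midpoint ℝ x y) ρ) ≤ (1 - 1 / 2) * dist (mk x r) (mk y r) := by
  have hd0 : 0 ≤ dist x y := dist_nonneg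
  have h1 : dist x (midpoint ℝ x y) = dist x y / 2 := by
    rw [dist_left_midpoint, Real.norm_ofNat]
    ring
  have h2 : dist y (midpoint ℝ x y) = dist x y / 2 := by
    rw [dist_right_midpoint, Real.norm_ofNat]
    ring
  have hcos : Real.cos (dist x y) = 2 * Real.cos (dist x y / 2) ^ 2 - 1 := by
    rw [← Real.cos_two_mul]
    ring_nf
  constructor <;>
  · refine (abs_le_of_sq_le_sq' ?_ (by positivity)).2
    rw [mul_pow, dist_mk_sq, dist_mk_sq, min_eq_right h]
    simp only [h1, h2]
    rw [min_eq_right (by linarith), hρ, hcos]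
    ring_nf
    rfl

end Comparison

/-! ### Uniform convexity -/

section UniformConvexity

theorem half_add_le_pMean {p : ℝ≥0∞} (hp : 1 ≤ p) {a b : ℝ} (ha : 0 ≤ a) (hb : 0 ≤ b) :
    (a + b) / 2 ≤ pMean p a b := by
  unfold pMean
  split_ifs with h
  · linarith [le_max_left a b, le_max_right a b]
  · have hq : 1 ≤ p.toReal := by
      have := ENNReal.toReal_mono h hp
      rwa [ENNReal.toReal_one] at this
    have h1 := (convexOn_rpow hq).2 ha hb (show (0 : ℝ) ≤ 1 / 2 by norm_num)
      (show (0 : ℝ) ≤ 1 / 2 by norm_num) (by norm_num)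
    simp only [smul_eq_mul] at h1
    have h2 : 0 ≤ 1 / 2 * a + 1 / 2 * b := by positivity
    calc (a + b) / 2 = 1 / 2 * a + 1 / 2 * b := by ring
      _ = ((1 / 2 * a + 1 / 2 * b) ^ p.toReal) ^ (1 / p.toReal) := by
        rw [← Real.rpow_mul h2, mul_one_div_cancel (by linarith), Real.rpow_one]
      _ ≤ _ := Real.rpow_le_rpow (Real.rpow_nonneg h2 _) h1 (by positivity)

theorem pMean_comm (p : ℝ≥0∞) (a b : ℝ) : pMean p a b = pMean p b a := by
  unfold pMean
  rw [max_comm, add_comm]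

theorem pMean_one {a b : ℝ} : pMean 1 a b = (a + b) / 2 := by
  simp only [pMean, ENNReal.one_ne_top, if_false, ENNReal.toReal_one, Real.rpow_one, div_one]
  ring

/-- The ratio of the `p`-mean to the arithmetic mean depends only on the relative gap `|a - b| / (a
+ b)` and grows with it. For finite `p`, `κ` is its value at the smallest gap allowed. -/
theorem exists_mul_half_add_le_pMean {p : ℝ≥0∞} (hp : 1 < p) {η : ℝ} (hη : 0 < η) :
    ∃ κ : ℝ, 1 < κ ∧ ∀ a b : ℝ, 0 ≤ a → 0 ≤ b → η * ((a + b) / 2) ≤ |a - b| →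
      κ * ((a + b) / 2) ≤ pMean p a b := by
  rcases eq_or_ne p ∞ with rfl | hpt
  · refine ⟨1 + η / 2, by linarith, fun a b _ _ hab => ?_⟩
    simp only [pMean, if_true]
    rcases abs_cases (a - b) with h | h
    · linarith [le_max_left a b]
    · linarith [le_max_right a b]
  set q := p.toReal with hq
  have hq1 : 1 < q := by
    have := (ENNReal.toReal_lt_toReal ENNReal.one_ne_top hpt).2 hp
    rwa [ENNReal.toReal_one] at this
  have hq0 : 0 < q := by linarith
  -- The relative gap is at least `η / 2`; the cap keeps `1 - v ≥ 0`.
  set v := min η 2 / 2 with hv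
  have hv0 : 0 < v := by
    have : 0 < min η 2 := lt_min hη two_pos
    linarith
  have hv1 : v ≤ 1 := by linarith [min_le_right η 2]
  have hvη : v ≤ η / 2 := by linarith [min_le_left η 2]
  set A := 1 / 2 * (1 + v) ^ q + 1 / 2 * (1 - v) ^ q with hA
  have hA1 : 1 < A := by
    have h1 := (strictConvexOn_rpow hq1).2 (x := 1 + v) (show (0 : ℝ) ≤ 1 + v by linarith)
      (y := 1 - v) (show (0 : ℝ) ≤ 1 - v by linarith) (by linarith)
      (show (0 : ℝ) < 1 / 2 by norm_num) (show (0 : ℝ) < 1 / 2 by norm_num) (by norm_num)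
    simp only [smul_eq_mul] at h1
    rwa [show (1 / 2 : ℝ) * (1 + v) + 1 / 2 * (1 - v) = 1 by ring, Real.one_rpow] at h1
  refine ⟨A ^ (1 / q), Real.one_lt_rpow hA1 (by positivity), ?_⟩
  have main : ∀ a b : ℝ, 0 ≤ a → 0 ≤ b → b ≤ a → η * ((a + b) / 2) ≤ |a - b| →
      A ^ (1 / q) * ((a + b) / 2) ≤ pMean p a b := by
    intro a b ha hb hba hab
    set M := (a + b) / 2 with hM
    rcases (show 0 ≤ M by positivity).eq_or_lt with h0 | hMpos
    · rw [← h0, mul_zero, h0]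
      exact half_add_le_pMean hp.le ha hb
    set u := (a - b) / (2 * M) with hu
    have huM : M * u = (a - b) / 2 := by
      rw [hu]
      field_simp
    rw [abs_of_nonneg (sub_nonneg.2 hba)] at hab
    have hvu : v ≤ u := by
      rw [hu, le_div_iff₀ (by positivity)]
      have := mul_le_mul_of_nonneg_right hvη hMpos.le
      linarith
    have hu0 : 0 < u := hv0.trans_le hvu
    have hu1 : u ≤ 1 := by
      rw [hu, div_le_one (by positivity)]
      linarith
    have ea : a = M * (1 + u) := by linarith
    have eb : b = M * (1 - u) := by linarith
    -- The numbers `1 ± v` are the means of `1 + u` and `1 - u` with weights `(1 ± s) / 2`, so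
    -- convexity gives monotonicity in the gap.
    set s := v / u with hs
    have hsu : s * u = v := div_mul_cancel₀ _ hu0.ne'
    have hs0 : 0 ≤ s := (div_pos hv0 hu0).le
    have hs1 : s ≤ 1 := (div_le_one hu0).2 hvu
    have m1 : (1 + u) ∈ Ici (0 : ℝ) := show (0 : ℝ) ≤ 1 + u by linarith
    have m2 : (1 - u) ∈ Ici (0 : ℝ) := show (0 : ℝ) ≤ 1 - u by linarith
    have c1 := (convexOn_rpow hq1.le).2 m1 m2 (show 0 ≤ (1 + s) / 2 by linarith)
      (show 0 ≤ (1 - s) / 2 by linarith) (by ring)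
    have c2 := (convexOn_rpow hq1.le).2 m1 m2 (show 0 ≤ (1 - s) / 2 by linarith)
      (show 0 ≤ (1 + s) / 2 by linarith) (by ring)
    simp only [smul_eq_mul] at c1 c2
    rw [show (1 + s) / 2 * (1 + u) + (1 - s) / 2 * (1 - u) = 1 + v by linarith] at c1
    rw [show (1 - s) / 2 * (1 + u) + (1 + s) / 2 * (1 - u) = 1 - v by linarith] at c2
    have hAu : A ≤ 1 / 2 * (1 + u) ^ q + 1 / 2 * (1 - u) ^ q := by linarith
    have hMq : (M ^ q) ^ (1 / q) = M := by
      rw [← Real.rpow_mul hMpos.le, mul_one_div_cancel hq0.ne', Real.rpow_one]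
    have hpm : pMean p a b = (1 / 2 * a ^ q + 1 / 2 * b ^ q) ^ (1 / q) := by
      simp only [pMean, if_neg hpt, hq]
    have h1 : A * M ^ q ≤ 1 / 2 * a ^ q + 1 / 2 * b ^ q := by
      rw [ea, eb, Real.mul_rpow hMpos.le m1, Real.mul_rpow hMpos.le m2]
      have := mul_le_mul_of_nonneg_right hAu (Real.rpow_nonneg hMpos.le q)
      linarith
    calc A ^ (1 / q) * M = (A * M ^ q) ^ (1 / q) := by
          rw [Real.mul_rpow (by linarith) (Real.rpow_nonneg hMpos.le q), hMq]
      _ ≤ _ := by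
        rw [hpm]
        exact Real.rpow_le_rpow (mul_nonneg (by linarith) (Real.rpow_nonneg hMpos.le q)) h1
          (by positivity)
  intro a b ha hb hab
  rcases le_total b a with h | h
  · exact main a b ha hb h hab
  · rw [pMean_comm, add_comm]
    rw [add_comm, abs_sub_comm] at hab
    exact main b a hb ha h hab

theorem exists_le_mul_half_add {ε : ℝ} (hε : 0 < ε) :
    ∃ ρ ∈ Ioo (0 : ℝ) 1, ∀ a b d μ : ℝ, 0 ≤ a → 0 ≤ b →
      μ ^ 2 ≤ (a ^ 2 + b ^ 2) / 2 - d ^ 2 / 4 → |a - b| + ε * ((a + b) / 2) < d →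
        μ ≤ (1 - ρ) * ((a + b) / 2) := by
  set δ := min ε 1 with hδ
  have hδ0 : 0 < δ := lt_min hε one_pos
  have hδ1 : δ ≤ 1 := min_le_right _ _
  have hδsq : δ ^ 2 ≤ 1 := pow_le_one₀ hδ0.le hδ1
  -- The hypotheses give `μ² ≤ (1 - δ² / 4) M²`, and `1 - δ² / 4 ≤ (1 - δ² / 8)²`.
  refine ⟨δ ^ 2 / 8, ⟨by positivity, by linarith⟩, fun a b d μ ha hb hμ hd => ?_⟩
  set M := (a + b) / 2 with hM
  have hM0 : 0 ≤ M := by positivity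
  have h1 : |a - b| + δ * M ≤ d := by
    have := mul_le_mul_of_nonneg_right (min_le_left ε 1) hM0
    linarith
  have h2 : (a - b) ^ 2 + δ ^ 2 * M ^ 2 ≤ d ^ 2 := by
    have h3 := pow_le_pow_left₀ (by positivity) h1 2
    have h4 : 0 ≤ |a - b| * (δ * M) := by positivity
    have h5 := sq_abs (a - b)
    nlinarith
  refine (abs_le_of_sq_le_sq' ?_ (mul_nonneg (by linarith) hM0)).2
  have h6 : 0 ≤ (δ ^ 2 / 8) ^ 2 * M ^ 2 := by positivity
  have h7 : (a ^ 2 + b ^ 2) / 2 = M ^ 2 + (a - b) ^ 2 / 4 := by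
    rw [hM]
    ring
  rw [h7] at hμ
  linarith

theorem StewartSpace.isUniformlyPConvex {X : Type*} [MetricSpace X] (h : StewartSpace X)
    {p : ℝ≥0∞} (hp : 1 ≤ p) : IsUniformlyPConvex X p := by
  have hmid : ∀ x y z m : X, IsMetricMidpoint m x y →
      dist m z ^ 2 ≤ (dist x z ^ 2 + dist y z ^ 2) / 2 - dist x y ^ 2 / 4 := by
    intro x y z m hm
    have := h.stewart_of_dist_le (x := x) (y := y) (m := m) (t := 1 / 2) (by norm_num)
      (by rw [hm.1]; linarith) (by rw [hm.2]; linarith) z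
    rw [dist_comm z m, dist_comm z x, dist_comm z y] at this
    linarith
  refine ⟨fun x y => ?_, fun ε hε => ?_⟩
  · obtain ⟨γ, hγ⟩ := h.exists_geodesic x y
    refine ⟨γ (1 / 2), ?_, ?_⟩
    · rw [hγ.dist_left (by norm_num)]
      ring
    · rw [hγ.dist_right (by norm_num)]
      ring
  rcases hp.eq_or_lt with rfl | hp1
  · obtain ⟨ρ, hρ, H⟩ := exists_le_mul_half_add hε
    refine ⟨ρ, hρ, fun x y z m hm hlt => ?_⟩
    rw [if_pos rfl, pMean_one] at hlt
    rw [pMean_one]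
    exact H _ _ _ _ dist_nonneg dist_nonneg (hmid x y z m hm) hlt
  · obtain ⟨ρ, hρ, H⟩ := exists_le_mul_half_add (half_pos hε)
    obtain ⟨κ, hκ, K⟩ := exists_mul_half_add_le_pMean hp1 (half_pos hε)
    have hκ0 : 0 < κ := by linarith
    have hκ1 : 1 / κ < 1 := (div_lt_one hκ0).2 hκ
    have hκ2 : 0 < 1 / κ := by positivity
    refine ⟨min ρ (1 - 1 / κ), ⟨lt_min hρ.1 (by linarith), (min_le_left _ _).trans_lt hρ.2⟩,
      fun x y z m hm hlt => ?_⟩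
    rw [if_neg hp1.ne', zero_add] at hlt
    have hm2 := hmid x y z m hm
    have htri : |dist x z - dist y z| ≤ dist x y := abs_dist_sub_le x y z
    set a := dist x z
    set b := dist y z
    have ha : 0 ≤ a := dist_nonneg
    have hb : 0 ≤ b := dist_nonneg
    have hle := half_add_le_pMean hp ha hb
    have hM0 : 0 ≤ (a + b) / 2 := by positivity
    have hP0 : 0 ≤ pMean p a b := hM0.trans hle
    -- Either `x, y` are far apart even in the sense of `p = 1`, or `|a - b|` is large and the
    -- `p`-mean exceeds the arithmetic mean by the factor `κ`.
    rcases lt_or_ge (|a - b| + ε / 2 * ((a + b) / 2)) (dist x y) with hc | hc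
    · calc dist m z ≤ (1 - ρ) * ((a + b) / 2) := H _ _ _ _ ha hb hm2 hc
        _ ≤ (1 - ρ) * pMean p a b := mul_le_mul_of_nonneg_left hle (by linarith [hρ.2])
        _ ≤ _ := mul_le_mul_of_nonneg_right (by linarith [min_le_left ρ (1 - 1 / κ)]) hP0
    · have h1 : ε / 2 * ((a + b) / 2) ≤ |a - b| := by
        have := mul_le_mul_of_nonneg_left hle hε.le
        linarith
      have h2 := K a b ha hb h1
      have h3 : dist m z ≤ (a + b) / 2 := by
        refine (abs_le_of_sq_le_sq' ?_ hM0).2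
        have h4 := pow_le_pow_left₀ (abs_nonneg _) htri 2
        rw [sq_abs] at h4
        linarith
      have h5 : (a + b) / 2 ≤ (1 / κ) * pMean p a b := by
        rw [one_div, ← div_eq_inv_mul, le_div_iff₀ hκ0]
        linarith
      exact (h3.trans h5).trans
        (mul_le_mul_of_nonneg_right (by linarith [min_le_right ρ (1 - 1 / κ)]) hP0)

end UniformConvexity

/-! ### The co-convex topology of a Hilbert space -/

section Weak

theorem isGeodesicallyConvex_iff_convex {E : Type*} [NormedAddCommGroup E]
    [InnerProductSpace ℝ E] {C : Set E} : IsGeodesicallyConvex C ↔ Convex ℝ C := by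
  have hE := stewartSpace_of_innerProductSpace (E := E)
  have hline : ∀ x y : E, IsGeodesic (AffineMap.lineMap x y : ℝ → E) x y := fun x y =>
    ⟨AffineMap.lineMap_apply_zero _ _, AffineMap.lineMap_apply_one _ _, fun s _ t _ => by
      rw [dist_lineMap_lineMap, Real.dist_eq]⟩
  rw [convex_iff_segment_subset]
  constructor
  · intro h x hx y hy
    rw [segment_eq_image_lineMap]
    rintro _ ⟨t, ht, rfl⟩
    exact h x hx y hy _ (hline x y) t ht
  · intro h x hx y hy γ hγ t ht
    rw [hE.geodesic_unique hγ (hline x y) ht]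
    refine h hx hy ?_
    rw [segment_eq_image_lineMap]
    exact mem_image_of_mem _ ht

/-- Half-spaces are closed and convex, so functionals are co-convexly continuous. Conversely,
norm-closed convex sets are weakly closed (Hahn–Banach). -/
theorem coconvexTopology_eq_weak {𝕜 H : Type*} [RCLike 𝕜] [NormedAddCommGroup H]
    [InnerProductSpace 𝕜 H] [CompleteSpace H] :
    coconvexTopology H = TopologicalSpace.induced (toWeakSpace 𝕜 H)
      (inferInstance : TopologicalSpace (WeakSpace 𝕜 H)) := by
  let _ : InnerProductSpace ℝ H := InnerProductSpace.rclikeToReal 𝕜 H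
  have hreal : ∀ g : H →L[ℝ] ℝ, Continuous[coconvexTopology H, inferInstance] g := by
    intro g
    rw [@OrderTopology.continuous_iff]
    refine fun a => ⟨TopologicalSpace.isOpen_generateFrom_of_mem ⟨?_, ?_⟩,
      TopologicalSpace.isOpen_generateFrom_of_mem ⟨?_, ?_⟩⟩
    · rw [← preimage_compl, compl_Ioi]
      exact isClosed_Iic.preimage g.continuous
    · rw [← preimage_compl, compl_Ioi]
      exact isGeodesicallyConvex_iff_convex.2 ((convex_Iic a).linear_preimage g.toLinearMap)
    · rw [← preimage_compl, compl_Iio]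
      exact isClosed_Ici.preimage g.continuous
    · rw [← preimage_compl, compl_Iio]
      exact isGeodesicallyConvex_iff_convex.2 ((convex_Ici a).linear_preimage g.toLinearMap)
  apply le_antisymm
  · rw [← continuous_iff_le_induced]
    refine @WeakBilin.continuous_of_continuous_eval _ _ _ _ _ _ _ _ _ _ _ (coconvexTopology H) _
      fun f => ?_
    have h1 := hreal (RCLike.reCLM.comp (f.restrictScalars ℝ))
    have h2 := hreal (RCLike.imCLM.comp (f.restrictScalars ℝ))
    let _ : TopologicalSpace H := coconvexTopology H
    have h3 := (RCLike.continuous_ofReal (K := 𝕜) |>.comp h1).add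
      ((RCLike.continuous_ofReal (K := 𝕜) |>.comp h2).mul_const RCLike.I)
    refine h3.congr fun x => ?_
    exact RCLike.re_add_im (f x)
  · refine le_generateFrom fun U hU => ?_
    have h1 : Convex ℝ Uᶜ := isGeodesicallyConvex_iff_convex.1 hU.2
    have h2 := h1.toWeakSpace_closure 𝕜
    rw [hU.1.closure_eq] at h2
    refine isOpen_induced_iff.2 ⟨(toWeakSpace 𝕜 H '' Uᶜ)ᶜ, ?_, ?_⟩
    · rw [h2]
      exact isClosed_closure.isOpen_compl
    · rw [preimage_compl, preimage_image_eq _ (toWeakSpace 𝕜 H).injective, compl_compl]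

end Weak

/-! ### Orthonormal sequences in the cone -/

section Sequences

open EuclideanCone

variable {E : Type*} [NormedAddCommGroup E]

/-- The squared asymptotic distance of `(v, t)` to a sequence `(eₙ, 1)` with orthonormal `eₙ`. -/
noncomputable def coneAsymptoticSq (v : E) (t : ℝ≥0) : ℝ :=
  (t : ℝ) ^ 2 + 1 - 2 * t * Real.cos (min Real.pi √(‖v‖ ^ 2 + 1))

theorem one_lt_pi : 1 < Real.pi := by linarith [Real.pi_gt_three]

theorem coe_toNNReal_cos_one : ((Real.cos 1).toNNReal : ℝ) = Real.cos 1 :=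
  Real.coe_toNNReal _ Real.cos_one_pos.le

/-- On the axis the value is `(t - cos 1)² + 1 - cos² 1`. Leaving the axis raises the angle above
`1`, which strictly lowers the cosine. -/
theorem coneAsymptoticSq_lt {v : E} {t : ℝ≥0} (h : mk v t ≠ mk 0 (Real.cos 1).toNNReal) :
    coneAsymptoticSq (0 : E) (Real.cos 1).toNNReal < coneAsymptoticSq v t := by
  have h0 : coneAsymptoticSq (0 : E) (Real.cos 1).toNNReal = 1 - Real.cos 1 ^ 2 := by
    rw [coneAsymptoticSq, coe_toNNReal_cos_one, norm_zero, zero_pow two_ne_zero, zero_add,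
      Real.sqrt_one, min_eq_right one_lt_pi.le]
    ring
  rw [h0, coneAsymptoticSq]
  have hc := Real.cos_one_pos
  rcases eq_zero_or_pos t with rfl | ht
  · simp only [NNReal.coe_zero]
    nlinarith
  have ht' : (0 : ℝ) < t := NNReal.coe_pos.2 ht
  rcases eq_or_ne v 0 with rfl | hv
  · rw [norm_zero, zero_pow two_ne_zero, zero_add, Real.sqrt_one, min_eq_right one_lt_pi.le]
    have hne : (t : ℝ) - Real.cos 1 ≠ 0 := by
      intro h1
      apply h
      congr 1
      rw [← NNReal.coe_inj, coe_toNNReal_cos_one]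
      linarith
    have := sq_pos_of_ne_zero hne
    nlinarith
  · have h1 : 1 < √(‖v‖ ^ 2 + 1) := by
      rw [Real.lt_sqrt zero_le_one]
      have := norm_pos_iff.2 hv
      nlinarith
    have h2 : Real.cos (min Real.pi √(‖v‖ ^ 2 + 1)) < Real.cos 1 :=
      Real.cos_lt_cos_of_nonneg_of_le_pi zero_le_one (min_le_left _ _) (lt_min one_lt_pi h1)
    have h3 := mul_lt_mul_of_pos_left h2 ht'
    nlinarith [sq_nonneg ((t : ℝ) - Real.cos 1)]

variable [InnerProductSpace ℝ E]

theorem Orthonormal.tendsto_inner_zero {e : ℕ → E} (he : Orthonormal ℝ e) (v : E) :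
    Tendsto (fun n => inner ℝ v (e n)) atTop (𝓝 0) := by
  have h1 := (he.inner_products_summable (x := v)).tendsto_atTop_zero.sqrt
  rw [Real.sqrt_zero] at h1
  rw [tendsto_zero_iff_norm_tendsto_zero]
  refine h1.congr fun n => ?_
  rw [Real.sqrt_sq (norm_nonneg _), real_inner_comm]

theorem Orthonormal.tendsto_dist {e : ℕ → E} (he : Orthonormal ℝ e) (v : E) :
    Tendsto (fun n => dist v (e n)) atTop (𝓝 √(‖v‖ ^ 2 + 1)) := by
  have h1 : Tendsto (fun n => √(‖v‖ ^ 2 - 2 * inner ℝ v (e n) + 1)) atTop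
      (𝓝 √(‖v‖ ^ 2 - 2 * 0 + 1)) :=
    ((tendsto_const_nhds.sub ((he.tendsto_inner_zero v).const_mul 2)).add_const 1).sqrt
  rw [mul_zero, sub_zero] at h1
  refine h1.congr fun n => ?_
  have h2 := norm_sub_sq_real v (e n)
  rw [he.1 n, one_pow] at h2
  rw [dist_eq_norm, ← h2, Real.sqrt_sq (norm_nonneg _)]

theorem Orthonormal.tendsto_dist_mk_sq {e : ℕ → E} (he : Orthonormal ℝ e) (v : E) (t : ℝ≥0) :
    Tendsto (fun n => dist (mk v t) (mk (e n) 1) ^ 2) atTop (𝓝 (coneAsymptoticSq v t)) := by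
  simp only [dist_mk_sq, NNReal.coe_one, one_pow, mul_one]
  exact tendsto_const_nhds.sub ((Real.continuous_cos.tendsto _ |>.comp
    (tendsto_const_nhds.min (he.tendsto_dist v))).const_mul _)

theorem Orthonormal.limsup_edist_mk {e : ℕ → E} (he : Orthonormal ℝ e) (v : E) (t : ℝ≥0) :
    limsup (fun n => edist (mk v t) (mk (e n) 1)) atTop
      = ENNReal.ofReal √(coneAsymptoticSq v t) := by
  refine Tendsto.limsup_eq ?_
  simp only [edist_dist]
  refine ENNReal.tendsto_ofReal ?_
  refine (he.tendsto_dist_mk_sq v t).sqrt.congr fun n => Real.sqrt_sq dist_nonneg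

theorem Orthonormal.coneAsymptoticSq_nonneg {e : ℕ → E} (he : Orthonormal ℝ e) (v : E) (t : ℝ≥0) :
    0 ≤ coneAsymptoticSq v t :=
  ge_of_tendsto' (he.tendsto_dist_mk_sq v t) fun _ => sq_nonneg _

theorem Orthonormal.weakSeqTendsto_mk {e : ℕ → E} (he : Orthonormal ℝ e) :
    WeakSeqTendsto (fun n => mk (e n) 1) (mk 0 (Real.cos 1).toNNReal) := by
  intro φ hφ y hy
  have he' : Orthonormal ℝ (e ∘ φ) := he.comp φ hφ.injective
  obtain ⟨v, t, rfl⟩ := exists_eq_mk y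
  have h1 := he'.limsup_edist_mk 0 (Real.cos 1).toNNReal
  have h2 := he'.limsup_edist_mk v t
  simp only [Function.comp_def] at h1 h2 ⊢
  rw [h1, h2]
  have h3 := he.coneAsymptoticSq_nonneg 0 (Real.cos 1).toNNReal
  have h4 := coneAsymptoticSq_lt hy
  exact (ENNReal.ofReal_lt_ofReal_iff (Real.sqrt_pos.2 (h3.trans_lt h4))).2
    (Real.sqrt_lt_sqrt h3 h4)

/-- The asymptotic center lies in every closed convex set that contains the sequence. -/
theorem Orthonormal.mk_cos_one_mem [CompleteSpace E] {e : ℕ → E} (he : Orthonormal ℝ e)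
    {C : Set (EuclideanCone E)} (hcl : IsClosed C) (hC : IsGeodesicallyConvex C)
    (hmem : ∀ n, mk (e n) 1 ∈ C) : mk 0 (Real.cos 1).toNNReal ∈ C := by
  have hS := EuclideanCone.stewartSpace (E := E)
  obtain ⟨q, hq⟩ := hS.exists_isNearestPoint ⟨_, hmem 0⟩ hcl hC (mk 0 (Real.cos 1).toNNReal)
  obtain ⟨v, t, rfl⟩ := exists_eq_mk q
  by_cases h : mk v t = mk 0 (Real.cos 1).toNNReal
  · exact h ▸ hq.1
  -- Projecting the asymptotic center to `C` increases no distance to points of `C`, so the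
  -- projection is asymptotically at least as close to the sequence.
  · have h1 := le_of_tendsto_of_tendsto' (he.tendsto_dist_mk_sq v t)
      (he.tendsto_dist_mk_sq 0 (Real.cos 1).toNNReal) fun n => by
        have := hS.sq_add_sq_le_of_isNearestPoint hC hq (hmem n)
        have := sq_nonneg (dist (mk (0 : E) (Real.cos 1).toNNReal) (mk v t))
        linarith
    exact absurd (coneAsymptoticSq_lt h) (not_lt.2 h1)

/-! #### Dyadic means -/

/-- The radius of the iterated midpoints of `2 ^ k` points `(eₙ, 1)`. -/
noncomputable def dyadicRadius (k : ℕ) : ℝ≥0 :=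
  ∏ i ∈ Finset.range k, (Real.cos √((1 / 2 : ℝ) ^ (i + 1))).toNNReal

theorem sqrt_half_pow_le_one (k : ℕ) : √((1 / 2 : ℝ) ^ (k + 1)) ≤ 1 :=
  Real.sqrt_le_one.2 (pow_le_one₀ (by norm_num) (by norm_num))

theorem cos_sqrt_half_pow_pos (k : ℕ) : 0 < Real.cos √((1 / 2 : ℝ) ^ (k + 1)) :=
  Real.cos_pos_of_le_one ((abs_of_nonneg (Real.sqrt_nonneg _)).trans_le (sqrt_half_pow_le_one k))

theorem one_sub_le_cos_sqrt_half_pow (k : ℕ) :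
    1 - (1 / 2 : ℝ) ^ (k + 1) / 2 ≤ Real.cos √((1 / 2 : ℝ) ^ (k + 1)) := by
  have := Real.one_sub_sq_div_two_le_cos (x := √((1 / 2 : ℝ) ^ (k + 1)))
  rwa [Real.sq_sqrt (by positivity)] at this

theorem coe_dyadicRadius_succ (k : ℕ) : (dyadicRadius (k + 1) : ℝ)
    = dyadicRadius k * Real.cos √((1 / 2 : ℝ) ^ (k + 1)) := by
  rw [dyadicRadius, Finset.prod_range_succ, NNReal.coe_mul,
    Real.coe_toNNReal _ (cos_sqrt_half_pow_pos k).le]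
  rfl

theorem sqrt_half_eq : √(1 / 2 : ℝ) = √2 / 2 := by
  rw [Real.sqrt_eq_iff_mul_self_eq (by norm_num) (by positivity),
    div_mul_div_comm, Real.mul_self_sqrt (by norm_num)]
  norm_num

theorem antitone_dyadicRadius : Antitone dyadicRadius := by
  refine antitone_nat_of_succ_le fun k => ?_
  rw [← NNReal.coe_le_coe, coe_dyadicRadius_succ]
  exact mul_le_of_le_one_right (dyadicRadius k).2 (Real.cos_le_one _)

theorem three_quarters_le_cos : 3 / 4 ≤ Real.cos (√2 / 2) := by
  have := one_sub_le_cos_sqrt_half_pow 0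
  rw [zero_add, pow_one, sqrt_half_eq] at this
  linarith

theorem cos_le_of_sqrt_two : Real.cos (√2 / 2) ≤ 49 / 64 := by
  have h0 : |√2 / 2| ≤ 1 := by
    rw [← sqrt_half_eq, abs_of_nonneg (Real.sqrt_nonneg _)]
    exact Real.sqrt_le_one.2 (by norm_num)
  have h1 := (abs_le.1 (Real.cos_bound h0)).2
  have h2 : (√2 / 2) ^ 2 = 1 / 2 := by
    rw [div_pow, Real.sq_sqrt (by norm_num)]
    norm_num
  have h3 : |√2 / 2| ^ 4 = 1 / 4 := by
    rw [show |√2 / 2| ^ 4 = (|√2 / 2| ^ 2) ^ 2 by ring, sq_abs, h2]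
    norm_num
  rw [h2, h3] at h1
  linarith

theorem le_dyadicRadius (k : ℕ) : Real.cos (√2 / 2) ^ 2 ≤ dyadicRadius k := by
  have hc0 : 0 < Real.cos (√2 / 2) := by linarith [three_quarters_le_cos]
  -- By `cos u ≥ 1 - u² / 2`, the second factor is at least `7/8` and the product of the later ones
  -- stays above `7/8`; the extra `2 ^ -(k + 3)` makes the induction close. Finally `49/64 ≥ cos (√2
  -- / 2)`.
  have key : ∀ k, Real.cos (√2 / 2) * (7 / 8 * (7 / 8 + (1 / 2) ^ (k + 3)))
      ≤ dyadicRadius (k + 2) := by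
    intro k
    induction k with
    | zero =>
      have h1 := one_sub_le_cos_sqrt_half_pow 1
      rw [zero_add, coe_dyadicRadius_succ, coe_dyadicRadius_succ, zero_add, pow_one, sqrt_half_eq]
      simp only [dyadicRadius, Finset.range_zero, Finset.prod_empty, NNReal.coe_one, one_mul]
      refine mul_le_mul_of_nonneg_left (le_trans (by norm_num) h1) hc0.le
    | succ k ih =>
      rw [coe_dyadicRadius_succ]
      have h1 := one_sub_le_cos_sqrt_half_pow (k + 2)
      have hh0 : (0 : ℝ) < (1 / 2) ^ (k + 3) := by positivity
      have hh1 : (1 / 2 : ℝ) ^ (k + 3) ≤ 1 / 8 := by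
        rw [pow_add]
        have : (1 / 2 : ℝ) ^ k ≤ 1 := pow_le_one₀ (by norm_num) (by norm_num)
        linarith
      have h2 : (1 / 2 : ℝ) ^ (k + 1 + 3) = (1 / 2) ^ (k + 3) / 2 := by ring
      rw [h2]
      change 1 - (1 / 2 : ℝ) ^ (k + 3) / 2 ≤ _ at h1
      set h := (1 / 2 : ℝ) ^ (k + 3)
      calc Real.cos (√2 / 2) * (7 / 8 * (7 / 8 + h / 2))
          ≤ Real.cos (√2 / 2) * (7 / 8 * (7 / 8 + h)) * (1 - h / 2) := by
            have : 7 / 8 * (7 / 8 + h / 2) ≤ 7 / 8 * (7 / 8 + h) * (1 - h / 2) := by nlinarith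
            have := mul_le_mul_of_nonneg_left this hc0.le
            linarith
        _ ≤ _ := mul_le_mul ih h1 (by linarith) (dyadicRadius _).2
  have h1 : (dyadicRadius (k + 2) : ℝ) ≤ dyadicRadius k :=
    NNReal.coe_le_coe.2 (antitone_dyadicRadius (Nat.le_add_right k 2))
  have h2 := key k
  have h3 : (0 : ℝ) < (1 / 2) ^ (k + 3) := by positivity
  have h4 := mul_le_mul_of_nonneg_left cos_le_of_sqrt_two hc0.le
  have h5 := mul_pos hc0 h3
  nlinarith

/-- Midpoints of disjoint pairs of orthogonal vectors of equal length are again orthogonal, with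
half the squared norm. Half the distance within a pair is `√(2 ^ -(k + 1))`, so the radius is
multiplied by its cosine. -/
theorem Orthonormal.exists_dyadic_mean {e : ℕ → E} (he : Orthonormal ℝ e)
    {C : Set (EuclideanCone E)} (hC : IsGeodesicallyConvex C) (hmem : ∀ n, mk (e n) 1 ∈ C)
    (k : ℕ) : ∃ g : ℕ → E, (∀ i j, inner ℝ (g i) (g j) = if i = j then (1 / 2 : ℝ) ^ k else 0) ∧
      ∀ n, mk (g n) (dyadicRadius k) ∈ C := by
  induction k with
  | zero =>
    refine ⟨e, fun i j => ?_, fun n => ?_⟩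
    · rw [orthonormal_iff_ite.1 he i j, pow_zero]
    · simpa [dyadicRadius] using hmem n
  | succ k ih =>
    obtain ⟨g, hg, hgC⟩ := ih
    refine ⟨fun n => midpoint ℝ (g (2 * n)) (g (2 * n + 1)), fun i j => ?_, fun n => ?_⟩
    · simp only [midpoint_eq_smul_add, inner_smul_left, inner_smul_right, inner_add_left,
        inner_add_right, hg]
      rcases eq_or_ne i j with rfl | hij
      · simp
        ring
      · simp [hij, show 2 * i ≠ 2 * j + 1 by omega, show 2 * i + 1 ≠ 2 * j by omega]
    · have hne : 2 * n ≠ 2 * n + 1 := by omega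
      have hdist : dist (g (2 * n)) (g (2 * n + 1)) / 2 = √((1 / 2 : ℝ) ^ (k + 1)) := by
        rw [eq_comm, Real.sqrt_eq_iff_mul_self_eq (by positivity) (by positivity),
          div_mul_div_comm, ← pow_two, dist_eq_norm, norm_sub_sq_real, ← real_inner_self_eq_norm_sq,
          ← real_inner_self_eq_norm_sq, hg, hg, hg, if_pos rfl, if_pos rfl, if_neg hne]
        ring
      have hle := sqrt_half_pow_le_one k
      have hm := midpoint_dist (x := g (2 * n)) (y := g (2 * n + 1))
        (by linarith [Real.pi_gt_three]) (dyadicRadius k) (ρ := dyadicRadius (k + 1))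
        (by rw [coe_dyadicRadius_succ, hdist])
      exact EuclideanCone.stewartSpace.mem_of_isGeodesicallyConvex hC (hgC _) (hgC _)
        (by norm_num) hm.1 hm.2

theorem Orthonormal.mk_iInf_dyadicRadius_mem {e : ℕ → E} (he : Orthonormal ℝ e)
    {C : Set (EuclideanCone E)} (hcl : IsClosed C) (hC : IsGeodesicallyConvex C)
    (hmem : ∀ n, mk (e n) 1 ∈ C) : mk 0 (⨅ k, dyadicRadius k) ∈ C := by
  choose g hg hgC using fun k => he.exists_dyadic_mean hC hmem k
  have h1 : Tendsto dyadicRadius atTop (𝓝 (⨅ k, dyadicRadius k)) :=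
    tendsto_atTop_ciInf antitone_dyadicRadius (OrderBot.bddBelow _)
  have h2 : Tendsto (fun k => g k 0) atTop (𝓝 0) := by
    rw [tendsto_zero_iff_norm_tendsto_zero]
    have h3 := (tendsto_pow_atTop_nhds_zero_of_lt_one (r := (1 / 2 : ℝ)) (by norm_num)
      (by norm_num)).sqrt
    rw [Real.sqrt_zero] at h3
    refine h3.congr fun k => ?_
    rw [← Real.sqrt_sq (norm_nonneg (g k 0)), ← real_inner_self_eq_norm_sq, hg, if_pos rfl]
  exact hcl.mem_of_tendsto ((continuous_mk.tendsto ((0 : E), ⨅ k, dyadicRadius k)).comp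
    (h2.prodMk_nhds h1)) (Eventually.of_forall fun k => hgC k 0)

end Sequences

/-! ### Weak limits of orthonormal sequences in the cone -/

section Limits

open EuclideanCone

variable {E F : Type*} [NormedAddCommGroup E] [NormedAddCommGroup F]

/-- The intersection of the closed convex hulls of the tails of `(eₙ, 1)`. -/
def tailHull (e : ℕ → E) : Set (EuclideanCone E) :=
  ⋂ m : ℕ, closedGeodesicHull {z | ∃ n, m ≤ n ∧ z = mk (e n) 1}

theorem tailHull_subset {e : ℕ → E} {C : Set (EuclideanCone E)} (hcl : IsClosed C)
    (hC : IsGeodesicallyConvex C) (m : ℕ) (hmem : ∀ n, m ≤ n → mk (e n) 1 ∈ C) :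
    tailHull e ⊆ C := by
  refine (iInter_subset _ m).trans (closedGeodesicHull_subset hcl hC ?_)
  rintro _ ⟨n, hn, rfl⟩
  exact hmem n hn

theorem isClosed_tailHull (e : ℕ → E) : IsClosed (tailHull e) :=
  isClosed_iInter fun _ => isClosed_closedGeodesicHull _

variable [InnerProductSpace ℝ E] [InnerProductSpace ℝ F]

theorem isGeodesicallyConvex_tailHull (e : ℕ → E) : IsGeodesicallyConvex (tailHull e) := by
  intro x hx y hy γ hγ t ht
  refine mem_iInter.2 fun m => ?_
  exact EuclideanCone.stewartSpace.isGeodesicallyConvex_closedGeodesicHull _ x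
    (mem_iInter.1 hx m) y (mem_iInter.1 hy m) γ hγ t ht

theorem image_tailHull [CompleteSpace F] {f : F → E} (hf : Isometry f) (e : ℕ → F) :
    EuclideanCone.map f '' tailHull e = tailHull (f ∘ e) := by
  rw [tailHull, (isometry_map hf).injective.injOn.image_iInter_eq, tailHull]
  refine iInter_congr fun m => ?_
  rw [EuclideanCone.stewartSpace.image_closedGeodesicHull EuclideanCone.stewartSpace
    (isometry_map hf)]
  congr 1
  ext z
  constructor
  · rintro ⟨_, ⟨n, hn, rfl⟩, rfl⟩
    exact ⟨n, hn, map_mk f _ _⟩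
  · rintro ⟨n, hn, rfl⟩
    exact ⟨_, ⟨n, hn, rfl⟩, map_mk f _ _⟩

theorem mk_zero_mem_of_mem {C : Set (EuclideanCone E)} (hC : IsGeodesicallyConvex C) {x : E}
    {r s t : ℝ≥0} (hr : mk x r ∈ C) (ht : mk x t ∈ C) (hrs : r ≤ s) (hst : s ≤ t) :
    mk x s ∈ C := by
  rcases (hrs.trans hst).eq_or_lt with h | h
  · rwa [le_antisymm (hst.trans h.ge) hrs]
  have h' : (0 : ℝ) < t - r := sub_pos.2 (NNReal.coe_lt_coe.2 h)
  have hrs' : (r : ℝ) ≤ s := NNReal.coe_le_coe.2 hrs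
  have hst' : (s : ℝ) ≤ t := NNReal.coe_le_coe.2 hst
  refine EuclideanCone.stewartSpace.mem_of_isGeodesicallyConvex hC hr ht (t := (s - r) / (t - r))
    ⟨div_nonneg (sub_nonneg.2 hrs') h'.le, (div_le_one h').2 (by linarith)⟩ ?_ ?_
  · rw [dist_mk_same, dist_mk_same, abs_sub_comm, abs_of_nonneg (sub_nonneg.2 hrs'), abs_sub_comm,
      abs_of_pos h', div_mul_cancel₀ _ h'.ne']
  · rw [dist_mk_same, dist_mk_same, abs_of_nonneg (sub_nonneg.2 hst'), abs_sub_comm,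
      abs_of_pos h', sub_mul, div_mul_cancel₀ _ h'.ne']
    linarith

/-- Reflection in the hyperplane orthogonal to `e k` induces an isometry of the cone that fixes
`(eₙ, 1)` for `n > k`. Its fixed points form a closed convex set, which therefore contains the tail
hull. -/
theorem Orthonormal.tailHull_subset_axis [CompleteSpace E] {e : ℕ → E} (he : Orthonormal ℝ e)
    (htotal : ∀ x : E, (∀ k, inner ℝ (e k) x = 0) → x = 0) {z : EuclideanCone E}
    (hz : z ∈ tailHull e) : ∃ r, z = mk 0 r := by
  obtain ⟨x, t, rfl⟩ := exists_eq_mk z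
  refine ⟨t, ?_⟩
  rcases eq_or_ne t 0 with rfl | ht
  · exact mk_zero x 0
  rw [htotal x fun k => ?_]
  set R := (Submodule.span ℝ {e k})ᗮ.reflection with hR
  have hiso : Isometry (EuclideanCone.map R) := isometry_map R.isometry
  have h1 := tailHull_subset (e := e) (isClosed_fixedPoints hiso.continuous)
    (EuclideanCone.stewartSpace.isGeodesicallyConvex_fixedPoints hiso) (k + 1) (fun n hn => by
      rw [Function.mem_fixedPoints, Function.IsFixedPt, map_mk,
        Submodule.reflection_mem_subspace_eq_self]
      rw [Submodule.mem_orthogonal_singleton_iff_inner_right]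
      exact he.2 (by omega)) hz
  rw [Function.mem_fixedPoints, Function.IsFixedPt, map_mk] at h1
  have h2 := (Submodule.reflection_eq_self_iff x).1 ((mk_eq_mk h1).2 ht)
  rwa [Submodule.mem_orthogonal_singleton_iff_inner_right] at h2

theorem Orthonormal.exists_tailHull_eq [CompleteSpace E] {e : ℕ → E} (he : Orthonormal ℝ e)
    (htotal : ∀ x : E, (∀ k, inner ℝ (e k) x = 0) → x = 0) :
    ∃ a b : ℝ≥0, a < b ∧ (a : ℝ) ≤ Real.cos 1 ∧ Real.cos (√2 / 2) ^ 2 ≤ (b : ℝ) ∧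
      tailHull e = {z | ∃ r ∈ Icc a b, z = mk 0 r} := by
  set R : Set ℝ≥0 := {r | mk 0 r ∈ tailHull e} with hR
  have htail : ∀ m, Orthonormal ℝ fun n => e (n + m) := fun m =>
    he.comp _ (add_left_injective m)
  have hmem : ∀ z, (∀ m : ℕ, ∀ C : Set (EuclideanCone E), IsClosed C → IsGeodesicallyConvex C →
      (∀ n, mk (e (n + m)) 1 ∈ C) → z ∈ C) → z ∈ tailHull e := fun z hz =>
    mem_iInter.2 fun m => hz m _ (isClosed_closedGeodesicHull _)
      (EuclideanCone.stewartSpace.isGeodesicallyConvex_closedGeodesicHull _) fun n =>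
        subset_closedGeodesicHull _ ⟨n + m, Nat.le_add_left m n, rfl⟩
  have hcos : (Real.cos 1).toNNReal ∈ R := hmem _ fun m C hcl hC h =>
    (htail m).mk_cos_one_mem hcl hC h
  have hdy : (⨅ k, dyadicRadius k) ∈ R := hmem _ fun m C hcl hC h =>
    (htail m).mk_iInf_dyadicRadius_mem hcl hC h
  have hcl : IsClosed R := (isClosed_tailHull e).preimage
    (continuous_mk.comp (Continuous.prodMk_right (0 : E)))
  have hord : OrdConnected R := ⟨fun r hr t ht s hs =>
    mk_zero_mem_of_mem (isGeodesicallyConvex_tailHull e) hr ht hs.1 hs.2⟩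
  have hR1 : R ⊆ Icc 0 1 := by
    intro r hr
    have h1 := tailHull_subset (e := e) (C := Metric.closedBall (mk 0 0) 1)
      Metric.isClosed_closedBall (EuclideanCone.stewartSpace.isGeodesicallyConvex_closedBall _ _) 0
      (fun n _ => by rw [Metric.mem_closedBall, dist_comm, dist_mk_zero, NNReal.coe_one]) hr
    rw [Metric.mem_closedBall, dist_comm, dist_mk_zero] at h1
    exact ⟨zero_le, h1⟩
  have hcpt : IsCompact R := isCompact_Icc.of_isClosed_subset hcl hR1
  have hIcc := eq_Icc_of_connected_compact ⟨⟨_, hcos⟩, hord.isPreconnected⟩ hcpt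
  have ha : (sInf R : ℝ≥0) ≤ (Real.cos 1).toNNReal := csInf_le hcpt.bddBelow hcos
  have hb : (⨅ k, dyadicRadius k) ≤ sSup R := le_csSup hcpt.bddAbove hdy
  have ha' : ((sInf R : ℝ≥0) : ℝ) ≤ Real.cos 1 := by
    rw [← coe_toNNReal_cos_one]
    exact NNReal.coe_le_coe.2 ha
  have hb' : Real.cos (√2 / 2) ^ 2 ≤ ((sSup R : ℝ≥0) : ℝ) := by
    refine le_trans ?_ (NNReal.coe_le_coe.2 hb)
    rw [NNReal.coe_iInf]
    exact le_ciInf le_dyadicRadius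
  refine ⟨sInf R, sSup R, ?_, ha', hb', ?_⟩
  -- Here `cos 1 < (3 / 4)² ≤ cos² (√2 / 2)` separates the ends.
  · rw [← NNReal.coe_lt_coe]
    have h1 := three_quarters_le_cos
    have h2 := Real.cos_one_le
    nlinarith
  · rw [← hIcc]
    ext z
    constructor
    · intro hz
      obtain ⟨r, rfl⟩ := he.tailHull_subset_axis htotal hz
      exact ⟨r, hz, rfl⟩
    · rintro ⟨r, hr, rfl⟩
      exact hr

/-- The standard unit vectors of `ℓ²`. -/
theorem orthonormal_lp_single :
    Orthonormal ℝ fun n : ℕ => lp.single (E := fun _ => ℝ) 2 n (1 : ℝ) := by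
  rw [orthonormal_iff_ite]
  intro i j
  rw [lp.inner_single_left]
  simp [lp.single_apply, Pi.single_apply]

/-- The intersections of the closed convex hulls of tails are the same for all orthonormal
sequences. -/
theorem exists_forall_tailHull_eq :
    ∃ a b : ℝ≥0, a < b ∧ (a : ℝ) ≤ Real.cos 1 ∧ Real.cos (√2 / 2) ^ 2 ≤ (b : ℝ) ∧
      ∀ e : ℕ → E, CompleteSpace E → Orthonormal ℝ e →
        tailHull e = {z | ∃ r ∈ Icc a b, z = mk 0 r} := by
  obtain ⟨a, b, hab, ha, hb, h⟩ := orthonormal_lp_single.exists_tailHull_eq fun x hx => by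
    ext k
    have := hx k
    rw [lp.inner_single_left] at this
    simpa using this
  refine ⟨a, b, hab, ha, hb, fun e _ he => ?_⟩
  -- Totality is available in `ℓ²`. The isometry onto the closed span of `e` carries hulls to hulls
  -- and fixes `0`, hence the segment is unchanged.
  set f := he.orthogonalFamily.linearIsometry with hf
  have hfe : (f ∘ fun n : ℕ => lp.single (E := fun _ => ℝ) 2 n (1 : ℝ)) = e := by
    funext n
    simp [hf]
  have h1 := image_tailHull f.isometry fun n : ℕ => lp.single (E := fun _ => ℝ) 2 n (1 : ℝ)
  rw [hfe, h] at h1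
  rw [← h1]
  ext z
  constructor
  · rintro ⟨_, ⟨r, hr, rfl⟩, rfl⟩
    exact ⟨r, hr, by rw [map_mk, map_zero]⟩
  · rintro ⟨r, hr, rfl⟩
    exact ⟨_, ⟨r, hr, rfl⟩, by rw [map_mk, map_zero]⟩

/-- A limit outside the closed hull of a tail would be separated from that tail. Conversely, if a
subbasic neighbourhood of `z` is missed infinitely often, a subsequence stays in its closed convex
complement, which then contains `A`; this is why all subsequences are needed. -/
theorem tendsto_coconvex_iff {e : ℕ → E} {A : Set (EuclideanCone E)}
    (h : ∀ φ : ℕ → ℕ, StrictMono φ → tailHull (e ∘ φ) = A) (z : EuclideanCone E) :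
    Tendsto (fun n => mk (e n) 1) atTop (@nhds _ (coconvexTopology (EuclideanCone E)) z)
      ↔ z ∈ A := by
  rw [TopologicalSpace.tendsto_nhds_generateFrom_iff]
  constructor
  · intro hz
    rw [← h id strictMono_id]
    refine mem_iInter.2 fun m => ?_
    by_contra hzm
    set K := closedGeodesicHull {z | ∃ n, m ≤ n ∧ z = mk ((e ∘ id) n) 1} with hK
    have h1 := hz Kᶜ ⟨by rw [compl_compl]; exact isClosed_closedGeodesicHull _, by
      rw [compl_compl]
      exact EuclideanCone.stewartSpace.isGeodesicallyConvex_closedGeodesicHull _⟩ hzm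
    obtain ⟨n, hn, hnm⟩ := ((mem_atTop_sets.1 h1).imp fun N hN =>
      ⟨hN (max N m) (le_max_left _ _), le_max_right N m⟩ : ∃ N, _ ∧ m ≤ max N m)
    exact hn (subset_closedGeodesicHull _ ⟨_, hnm, rfl⟩)
  · intro hz U hU hzU
    by_contra hcon
    obtain ⟨φ, hφ, hφU⟩ := extraction_of_frequently_atTop
      (P := fun n => mk (e n) 1 ∈ Uᶜ) (fun h' => hcon (by
        filter_upwards [h'] with n hn using not_not.1 hn))
    have h1 := tailHull_subset (e := e ∘ φ) hU.1 hU.2 0 fun n _ => hφU n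
    rw [h φ hφ] at h1
    exact h1 hz hzU

end Limits

/-! ### Projections onto geodesics in the cone -/

section PropertyN

open EuclideanCone

variable {E : Type*} [NormedAddCommGroup E]

theorem isGeodesic_mk_zero : IsGeodesic (fun t : ℝ => mk (0 : E) t.toNNReal) (mk 0 0) (mk 0 1) := by
  refine ⟨by simp, by simp, fun s hs t ht => ?_⟩
  rw [dist_mk_same, dist_mk_zero, Real.coe_toNNReal _ hs.1, Real.coe_toNNReal _ ht.1,
    NNReal.coe_one, mul_one]

theorem isNearestPoint_axis {v : E} (hv : ‖v‖ ≤ Real.pi) {t c : ℝ≥0}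
    (hc : (c : ℝ) = t * Real.cos ‖v‖) (hc1 : c ≤ 1) :
    IsNearestPoint ((fun t : ℝ => mk (0 : E) t.toNNReal) '' Icc 0 1) (mk v t) (mk 0 c) := by
  refine ⟨⟨c, ⟨c.2, hc1⟩, by simp⟩, ?_⟩
  rintro _ ⟨r, hr, rfl⟩
  refine (abs_le_of_sq_le_sq' ?_ dist_nonneg).2
  simp only [dist_mk_sq, dist_zero_right, min_eq_right hv, Real.coe_toNNReal _ hr.1]
  rw [hc]
  nlinarith [sq_nonneg (r - t * Real.cos ‖v‖)]

/-- Both `(x, 1)` and `(y, 1)` project to radius `cos 1` on the axis, so the geodesic between the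
projections is constant. Their midpoint has radius `cos (√2 / 2)` and angle `√2 / 2` to the axis, so
it projects to `cos² (√2 / 2)`. -/
theorem not_hasPropertyN [InnerProductSpace ℝ E] {x y : E} (hx : ‖x‖ = 1) (hy : ‖y‖ = 1)
    (hxy : inner ℝ x y = 0) : ¬ HasPropertyN (EuclideanCone E) := by
  intro hN
  have hS := EuclideanCone.stewartSpace (E := E)
  have hd : dist x y / 2 = √2 / 2 := by
    congr 1
    rw [eq_comm, Real.sqrt_eq_iff_mul_self_eq (by norm_num) dist_nonneg, ← pow_two, dist_eq_norm,
      norm_sub_sq_real, hx, hy, hxy]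
    norm_num
  have hm : ‖midpoint ℝ x y‖ = √2 / 2 := by
    rw [← sqrt_half_eq, eq_comm, Real.sqrt_eq_iff_mul_self_eq (by norm_num) (norm_nonneg _),
      ← pow_two, midpoint_eq_smul_add, norm_smul, mul_pow, norm_add_sq_real, hx, hy, hxy]
    norm_num
  have h34 := three_quarters_le_cos
  have hc0 : 0 ≤ Real.cos (√2 / 2) := by linarith
  have hs1 : √2 / 2 ≤ 1 := by
    rw [← sqrt_half_eq]
    exact Real.sqrt_le_one.2 (by norm_num)
  have hπ := Real.pi_gt_three
  set ρ : ℝ≥0 := (Real.cos (√2 / 2)).toNNReal with hρ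
  have hρ' : (ρ : ℝ) = Real.cos (√2 / 2) := Real.coe_toNNReal _ hc0
  have hmid := midpoint_dist (x := x) (y := y) (by linarith) 1 (ρ := ρ)
    (by rw [hρ', hd, NNReal.coe_one, one_mul])
  obtain ⟨σ, hσ⟩ := hS.exists_geodesic (mk x 1) (mk y 1)
  have hσm := hS.eq_of_isGeodesic hσ (by norm_num) hmid.1 hmid.2
  have hle1 : ∀ v : E, ‖v‖ = 1 →
      IsNearestPoint ((fun t : ℝ => mk (0 : E) t.toNNReal) '' Icc 0 1) (mk v 1)
        (mk 0 (Real.cos 1).toNNReal) := fun v hv =>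
    isNearestPoint_axis (by rw [hv]; linarith)
      (by rw [hv, coe_toNNReal_cos_one, NNReal.coe_one, one_mul])
      (by rw [← NNReal.coe_le_coe, coe_toNNReal_cos_one]; exact Real.cos_le_one 1)
  have hρ1 : ρ ≤ 1 := by
    rw [← NNReal.coe_le_coe, hρ']
    exact Real.cos_le_one _
  obtain ⟨τ, hτ, s, hs, hτs⟩ := hN _ _ _ isGeodesic_mk_zero _ _ σ hσ (1 / 2) (by norm_num)
    _ _ (mk 0 (ρ * ρ)) (hle1 x hx) (hle1 y hy) (by
      rw [hσm]
      exact isNearestPoint_axis (by rw [hm]; linarith)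
        (by rw [hm, NNReal.coe_mul, hρ']) (mul_le_one' hρ1 hρ1))
  rw [hτ.eq_of_self hs] at hτs
  have h1 := congrArg NNReal.toReal (mk_eq_mk hτs).1
  rw [coe_toNNReal_cos_one, NNReal.coe_mul, hρ'] at h1
  nlinarith [Real.cos_one_le]

end PropertyN

/-! ### Real and complex scalars, and the assembly. -/

theorem exists_orthonormal_nat {𝕜 H : Type*} [RCLike 𝕜] [NormedAddCommGroup H]
    [InnerProductSpace 𝕜 H] [CompleteSpace H] (hH : ¬ FiniteDimensional 𝕜 H) :
    ∃ e : ℕ → H, Orthonormal 𝕜 e := by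
  obtain ⟨w, b, -⟩ := exists_hilbertBasis 𝕜 H
  have hw : Infinite w := by
    by_contra hfin
    rw [not_infinite_iff_finite] at hfin
    have := Fintype.ofFinite w
    exact hH (Module.Basis.finiteDimensional_of_finite b.toOrthonormalBasis.toBasis)
  exact ⟨_, b.orthonormal.comp (Infinite.natEmbedding w) (Infinite.natEmbedding w).injective⟩

theorem Orthonormal.rclikeToReal {𝕜 H ι : Type*} [RCLike 𝕜] [NormedAddCommGroup H]
    [InnerProductSpace 𝕜 H] {e : ι → H} (he : Orthonormal 𝕜 e) :
    @Orthonormal ℝ H _ _ (InnerProductSpace.rclikeToReal 𝕜 H) ι e := by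
  let _ : InnerProductSpace ℝ H := InnerProductSpace.rclikeToReal 𝕜 H
  refine ⟨he.1, fun i j hij => ?_⟩
  change RCLike.re (inner 𝕜 (e i) (e j)) = 0
  rw [he.2 hij, map_zero]

theorem mainTheorem5 {𝕜 H : Type*} [RCLike 𝕜] [NormedAddCommGroup H] [InnerProductSpace 𝕜 H]
    [CompleteSpace H] (hH : ¬ FiniteDimensional 𝕜 H) :
    -- the cone is a complete `CAT(0)` space, hence uniformly convex
    CompleteSpace (EuclideanCone H) ∧ IsCAT0 (EuclideanCone H) ∧
    (∀ p : ℝ≥0∞, 1 ≤ p → IsUniformlyPConvex (EuclideanCone H) p) ∧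
    -- its bounded closed convex subsets are compact in the co-convex topology
    (∀ C : Set (EuclideanCone H), Bornology.IsBounded C → IsClosed C → IsGeodesicallyConvex C →
      @IsCompact _ (coconvexTopology (EuclideanCone H)) C) ∧
    -- on `H` itself the co-convex topology is the weak topology
    coconvexTopology H =
      TopologicalSpace.induced (toWeakSpace 𝕜 H) (inferInstance : TopologicalSpace (WeakSpace 𝕜 H)) ∧
    -- on the cone the co-convex topology is not Hausdorff
    ¬ @T2Space (EuclideanCone H) (coconvexTopology (EuclideanCone H)) ∧
    -- the sequence `(eₙ, 1)`
    (∀ e : ℕ → H, Orthonormal 𝕜 e →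
      (∃ a b : ℝ≥0, a < b ∧ (a : ℝ) ≤ Real.cos 1 ∧ Real.cos (√2 / 2) ^ 2 ≤ (b : ℝ) ∧
        (∀ φ : ℕ → ℕ, StrictMono φ →
          ⋂ m : ℕ, closedGeodesicHull {z | ∃ n, m ≤ n ∧ z = EuclideanCone.mk (e (φ n)) 1}
            = {z | ∃ r ∈ Icc a b, z = EuclideanCone.mk 0 r}) ∧
        ∀ z : EuclideanCone H,
          Tendsto (fun n => EuclideanCone.mk (e n) 1) atTop
              (@nhds _ (coconvexTopology (EuclideanCone H)) z)
            ↔ ∃ r ∈ Icc a b, z = EuclideanCone.mk 0 r) ∧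
      WeakSeqTendsto (fun n => EuclideanCone.mk (e n) 1)
        (EuclideanCone.mk 0 (Real.cos 1).toNNReal)) ∧
    -- the cone does not have nice projections onto geodesics
    ¬ HasPropertyN (EuclideanCone H) := by
  -- The real part of the inner product induces the same norm, hence the same cone, and keeps
  -- orthonormal sequences orthonormal.
  let _ : InnerProductSpace ℝ H := InnerProductSpace.rclikeToReal 𝕜 H
  have hS : StewartSpace (EuclideanCone H) := EuclideanCone.stewartSpace
  obtain ⟨a, b, hab, ha, hb, hseg⟩ := exists_forall_tailHull_eq (E := H)
  have hsub : ∀ e : ℕ → H, Orthonormal 𝕜 e → ∀ φ : ℕ → ℕ, StrictMono φ →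
      tailHull (e ∘ φ) = {z | ∃ r ∈ Icc a b, z = EuclideanCone.mk 0 r} := fun e he φ hφ =>
    hseg _ inferInstance (he.comp φ hφ.injective).rclikeToReal
  obtain ⟨e, he⟩ := exists_orthonormal_nat hH
  refine ⟨inferInstance, hS.isCAT0, fun p hp => hS.isUniformlyPConvex hp,
    fun C hb hcl hC => hS.isCompact_coconvex hb hcl hC, coconvexTopology_eq_weak, ?_,
    fun e he => ⟨⟨a, b, hab, ha, hb, hsub e he, tendsto_coconvex_iff (hsub e he)⟩,
      he.rclikeToReal.weakSeqTendsto_mk⟩,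
    not_hasPropertyN (he.rclikeToReal.1 0) (he.rclikeToReal.1 1)
      (he.rclikeToReal.2 zero_ne_one)⟩
  intro hT2
  have hlim := tendsto_coconvex_iff (hsub e he)
  have h1 := @tendsto_nhds_unique _ _ (coconvexTopology (EuclideanCone H)) hT2 _ _ _ _ _
    ((hlim (EuclideanCone.mk 0 a)).2 ⟨a, ⟨le_rfl, hab.le⟩, rfl⟩)
    ((hlim (EuclideanCone.mk 0 b)).2 ⟨b, ⟨hab.le, le_rfl⟩, rfl⟩)
  exact hab.ne (EuclideanCone.mk_eq_mk h1).1
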